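/- Let $p$ and $\ell$ be distinct odd primes and $k\ge 1$ an integer such that $p$ is a primitive root modulo $2\ell^k$. Put $e=\phi(\ell^k)=(\ell-1)\ell^{k-1}$ ($\phi$ is Euler's function), $q=p^e$ and $N=\frac{q-1}{2\ell^k}$, and let $\operatorname{Tr}$ be the trace map from $\mathbb{F}_q$ to $\mathbb{F}_p$. For $u\in\mathbb{F}_p$ let $$D_u=\{(x,y)\in\mathbb{F}_q^2\setminus\{(0,0)\}:\operatorname{Tr}(x+y^N)=u\},\qquad \mathcal{C}_{D_u}=\{(\operatorname{Tr}(\gamma x+\delta y))_{(x,y)\in D_u}:\gamma,\delta\in\mathbb{F}_q\}.$$ Then $\mathcal{C}_{D_u}$ is a linear code over $\mathbb{F}_p$ of length $p^{2e-1}-1$ if $u=0$ and $p^{2e-1}$ if $u\ne 0$, and of dimension $2e$. Its weight distribution is given below as a list of entries "weight : frequency". The zero codeword (weight $0$, frequency $1$) is always part of the list and is not repeated; frequencies of entries with equal weight are to be added, and an entry of frequency $0$ is void. A code is called $t$-weight if exactly $t$ nonzero Hamming weights occur among its codewords. 1. If $u=0$ and $\ell\equiv 1\pmod p$: - $p^{e-1}(\ell-1)\frac{q-1}{\ell^k}$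 : $p-1$ - $p^{2e-2}(p-1)+p^{e-1}\left(\sqrt q-(\ell-1)\frac{\sqrt q+1}{\ell^k}\right)$ : $(p-1)(\ell-1)\frac{q-1}{\ell^k}$ - $p^{2e-2}(p-1)-p^{e-1}(\ell-1)\frac{\sqrt q+1}{\ell^k}$ : $(p-1)(\ell^k-\ell+1)\frac{q-1}{\ell^k}$ - $p^{2e-2}(p-1)$ : $(q-1)+(q-p)q$ and the code is four-weight. 2. If $u=0$ and $\ell\not\equiv 1\pmod p$: - $p^{e-1}\frac{q-1}{\ell^{k-1}}$ : $p-1$ - $p^{2e-2}(p-1)+p^{e-1}\left(\sqrt q-\frac{\sqrt q+1}{\ell^{k-1}}\right)$ : $(p-1)\frac{q-1}{\ell^{k-1}}$ - $p^{2e-2}(p-1)-p^{e-1}\frac{\sqrt q+1}{\ell^{k-1}}$ : $(p-1)(\ell^{k-1}-1)\frac{q-1}{\ell^{k-1}}$ - $p^{2e-2}(p-1)$ : $(q-1)+(q-p)q$ and the code is four-weight if $k\ge 2$ and three-weight if $k=1$. 3. If $u\ne 0$, $u^2\not\equiv\phi(\ell^k)^2\pmod p$ and $u^2\not\equiv\ell^{2(k-1)}\pmod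 p$: - $p^{2e-1}$ : $p-1$ - $p^{2e-2}(p-1)$ : $q^2-p$ and the code is two-weight. 4. If $u\ne 0$, $u^2\equiv\phi(\ell^k)^2\pmod p$ and $u^2\not\equiv\ell^{2(k-1)}\pmod p$: - $p^{2e-1}-p^{e-1}\frac{q-1}{2\ell^k}$ : $p-1$ - $p^{2e-2}(p-1)-p^{e-1}\sqrt q+p^{e-1}\frac{\sqrt q+1}{2\ell^k}$ : $(p-1)\frac{q-1}{2\ell^k}$ - $p^{2e-2}(p-1)+p^{e-1}\frac{\sqrt q+1}{2\ell^k}$ : $(p-1)(2\ell^k-1)\frac{q-1}{2\ell^k}$ - $p^{2e-2}(p-1)$ : $(q-1)+q(q-p)$ and the code is four-weight, except that it is three-weight for $(p,\ell,k)=(5,3,1)$ and $(11,3,1)$. 5. If $u\ne 0$ and either $u\equiv\phi(\ell^k)\equiv\ell^{k-1}\pmod p$ or $u\equiv-\phi(\ell^k)\equiv-\ell^{k-1}\pmod p$: - $p^{2e-1}-p^{e-1}\frac{q-1}{2\ell^{k-1}}$ : $p-1$ - $p^{2e-2}(p-1)-p^{e-1}\sqrt q+p^{e-1}\frac{\sqrt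 q+1}{2\ell^{k-1}}$ : $(p-1)\frac{q-1}{2\ell^{k-1}}$ - $p^{2e-2}(p-1)+p^{e-1}\frac{\sqrt q+1}{2\ell^{k-1}}$ : $(p-1)(2\ell^{k-1}-1)\frac{q-1}{2\ell^{k-1}}$ - $p^{2e-2}(p-1)$ : $(q-1)+q(q-p)$ and the code is four-weight. 6. If $u\ne 0$, $u^2\not\equiv\phi(\ell^k)^2\pmod p$ and $u^2\equiv\ell^{2(k-1)}\pmod p$: - $p^{2e-1}-p^{e-1}(\ell-1)\frac{q-1}{2\ell^k}$ : $p-1$ - $p^{2e-2}(p-1)-p^{e-1}\sqrt q+p^{e-1}(\ell-1)\frac{\sqrt q+1}{2\ell^k}$ : $(p-1)(\ell-1)\frac{q-1}{2\ell^k}$ - $p^{2e-2}(p-1)+p^{e-1}(\ell-1)\frac{\sqrt q+1}{2\ell^k}$ : $(p-1)(2\ell^k-\ell+1)\frac{q-1}{2\ell^k}$ - $p^{2e-2}(p-1)$ : $(q-1)+q(q-p)$ and the code is four-weight, except that it is three-weight for $(p,\ell,k)=(5,3,1)$. -/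

import Mathlib

noncomputable section

namespace TraceCode

/-- The set of all `(x, y) ≠ (0, 0)` in `F × F` with `Tr (x + y ^ N) = u`, where `Tr` is the
trace from `F` to the prime field. -/
def definingSet (p : ℕ) (F : Type*) [Field F] [Fintype F] [DecidableEq F] [Algebra (ZMod p) F]
    (N : ℕ) (u : ZMod p) : Finset (F × F) :=
  Finset.univ.filter fun z =>
    z ≠ (0, 0) ∧ Algebra.trace (ZMod p) F (z.1 + z.2 ^ N) = u

/-- The map sending `(γ, δ)` to the word `(Tr (γ x + δ y))`, with coordinates indexed by the
points `(x, y)` of `D`. -/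
def codeword (p : ℕ) {F : Type*} [Field F] [Algebra (ZMod p) F] (D : Finset (F × F)) :
    (F × F) →ₗ[ZMod p] (D → ZMod p) where
  toFun g := fun d => Algebra.trace (ZMod p) F (g.1 * d.1.1 + g.2 * d.1.2)
  map_add' g h := by
    funext d
    simp only [Prod.fst_add, Prod.snd_add, Pi.add_apply, ← map_add]
    congr 1
    ring
  map_smul' a g := by
    funext d
    simp only [Prod.smul_fst, Prod.smul_snd, smul_mul_assoc, ← smul_add, map_smul,
      RingHom.id_apply, Pi.smul_apply]

/-- The linear code `{(Tr (γ x + δ y))_{(x, y) ∈ D} : γ, δ ∈ F}`; its length is `D.card`. -/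
def code (p : ℕ) {F : Type*} [Field F] [Algebra (ZMod p) F] (D : Finset (F × F)) :
    Submodule (ZMod p) (D → ZMod p) :=
  LinearMap.range (codeword p D)

/-- The number `A_w` of codewords of Hamming weight `w`. -/
def weightCount {p : ℕ} {ι : Type*} [Fintype ι] (C : Submodule (ZMod p) (ι → ZMod p))
    (w : ℕ) : ℕ :=
  Set.ncard {c : ι → ZMod p | c ∈ C ∧ hammingNorm c = w}

/-- `C` is a `t`-weight code: exactly `t` positive integers are weights of codewords. -/
def IsWeightCode {p : ℕ} {ι : Type*} [Fintype ι] (t : ℕ)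
    (C : Submodule (ZMod p) (ι → ZMod p)) : Prop :=
  Set.ncard {w : ℕ | 1 ≤ w ∧ weightCount C w ≠ 0} = t

/-- `C` has the weight distribution given by a table of rows `(weight, frequency)`: for every `w`,
the number of codewords of weight `w` is the sum of the frequencies of the rows with weight `w`
(so rows of equal weight are merged, and a row of frequency zero contributes nothing). -/
def HasWeightTable {p : ℕ} {ι : Type*} [Fintype ι] (C : Submodule (ZMod p) (ι → ZMod p))
    (T : List (ℝ × ℝ)) : Prop :=
  ∀ w : ℕ, (weightCount C w : ℝ) = (T.map fun r => if r.1 = (w : ℝ) then r.2 else 0).sum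

end TraceCode

end

/-! Write `Q = p ^ (s + 1)` with `e = 2 * (s + 1)`, so that `q = Q ^ 2`, and put `M = 2 ℓ ^ k` and
`f y = Tr (y ^ N)`. As `p` is a primitive root, `Q` is congruent to `-1` modulo `ℓ ^ k`. Hence `M *
r = Q + 1` for some `r`, and `N = (Q - 1) * r`. So `f` is invariant under multiplication by units of
the subfield `K` of order `Q`. This invariance replaces any evaluation of character sums.

The weight of the word of `(γ, δ)` is the number of `(x, y)` with `Tr x + f y = u` and `Tr (γ x) +
Tr (δ y) ≠ 0`. If `γ` is outside the prime field, `Tr x` and `Tr (γ x)` are independent and the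
weight is a constant. If `γ = c` lies in the prime field, `Tr (γ x) = c (u - f y)` is determined by
`y`. For `c ≠ 0`, after scaling `δ`, it remains to count the `y` with `f y - Tr (δ y) ≠ u`. For `δ ≠
0` this count is averaged over `K`-lines: `c ↦ Tr (z c)` is equidistributed on `K`, except for `z`
on a single line `z₀ K`. The result takes two values, according to whether `f (z₀ / δ) = u`
(`exists_card_filter_sub_trace_mul`, `exists_card_filter_pow_trace_ne`). Everything is thus
expressed by the number `n` of `M`-th roots of unity of trace `u` (`sum_hammingNorm_codeword`), and
all nonzero pairs turn out to have nonzero weight, which gives the dimension.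

The number `n` comes from Ramanujan sums. The conjugates of an `ℓ ^ k`-th root of unity `ω` are its
powers with exponents prime to `ℓ`, so its trace is `φ (ℓ ^ k)` for `ω = 1`, `-ℓ ^ (k - 1)` for
order `ℓ`, and `0` otherwise. The remaining `M`-th roots are the negatives of these.

The number of distinct weights is a question of elementary arithmetic. Two weights coincide only if
a small multiple of `r` is a power of `p`, one more than such a power, or a difference of two
consecutive powers. Since `r` divides `p ^ (s + 1) + 1` it is prime to `p`, and divisibility and
size leave only the listed exceptions. -/

namespace TraceCode

/-! ### Power maps and roots of unity in a finite field -/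

section FiniteFieldCounting

variable {F : Type*} [Field F] [Fintype F] [DecidableEq F]

theorem exists_isPrimitiveRoot_of_dvd {d : ℕ} (hd : d ∣ Fintype.card F - 1) :
    ∃ ζ : F, IsPrimitiveRoot ζ d := by
  obtain ⟨g, hg⟩ := IsCyclic.exists_generator (α := Fˣ)
  have h1 : orderOf g = Fintype.card F - 1 := by
    rw [orderOf_eq_card_of_forall_mem_zpowers hg, Nat.card_eq_fintype_card, Fintype.card_units]
  have h2 : IsPrimitiveRoot (g : F) (Fintype.card F - 1) := by
    rw [← h1, IsPrimitiveRoot.coe_units_iff]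
    exact IsPrimitiveRoot.orderOf g
  obtain ⟨c, hc⟩ := hd
  have h0 : 0 < Fintype.card F - 1 := Nat.sub_pos_of_lt Fintype.one_lt_card
  exact ⟨_, h2.pow h0 (hc.trans (mul_comm d c))⟩

theorem card_filter_pow_eq_one {d : ℕ} (hd : d ∣ Fintype.card F - 1) :
    (Finset.univ.filter fun x : F => x ^ d = 1).card = d := by
  have h0 : 0 < Fintype.card F - 1 := Nat.sub_pos_of_lt Fintype.one_lt_card
  have hd0 : 0 < d := Nat.pos_of_dvd_of_pos hd h0
  obtain ⟨ζ, hζ⟩ := exists_isPrimitiveRoot_of_dvd hd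
  refine Eq.trans (congrArg _ ?_) hζ.card_nthRootsFinset
  ext x
  simp [Polynomial.mem_nthRootsFinset hd0]

/-- For a generator `g` of the cyclic group of units, `g ^ N` is a primitive `M`-th root of unity,
so `ω` is one of its powers. -/
theorem exists_pow_eq_of_pow_eq_one {N M : ℕ} (hNM : N * M = Fintype.card F - 1) {ω : F}
    (hω : ω ^ M = 1) : ∃ y : F, y ^ N = ω := by
  have h0 : 0 < Fintype.card F - 1 := Nat.sub_pos_of_lt Fintype.one_lt_card
  have hM : 0 < M := Nat.pos_of_ne_zero (by rintro rfl; simp at hNM; omega)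
  obtain ⟨g, hg⟩ := exists_isPrimitiveRoot_of_dvd (F := F) dvd_rfl
  have : NeZero M := ⟨hM.ne'⟩
  obtain ⟨i, -, hi⟩ := (hg.pow h0 hNM.symm).eq_pow_of_pow_eq_one hω
  exact ⟨g ^ i, by rw [← hi, ← pow_mul, ← pow_mul, mul_comm]⟩

/-- The fibre is a coset of the group of `N`-th roots of unity. -/
theorem card_filter_pow_eq {N M : ℕ} (hNM : N * M = Fintype.card F - 1) {ω : F}
    (hω : ω ^ M = 1) : (Finset.univ.filter fun x : F => x ^ N = ω).card = N := by
  have h0 : 0 < Fintype.card F - 1 := Nat.sub_pos_of_lt Fintype.one_lt_card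
  have hM : 0 < M := Nat.pos_of_ne_zero (by rintro rfl; simp at hNM; omega)
  have hN : 0 < N := Nat.pos_of_ne_zero (by rintro rfl; simp at hNM; omega)
  have hω0 : ω ≠ 0 := by rintro rfl; simp [hM.ne'] at hω
  obtain ⟨y, hy⟩ := exists_pow_eq_of_pow_eq_one hNM hω
  have hy0 : y ≠ 0 := by rintro rfl; exact hω0 (by rw [← hy, zero_pow hN.ne'])
  refine Eq.trans ?_ (card_filter_pow_eq_one (F := F) (Dvd.intro _ hNM))
  refine Finset.card_bij' (fun x _ => x / y) (fun x _ => x * y) ?_ ?_ ?_ ?_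
  · intro x hx
    simp only [Finset.mem_filter_univ] at hx ⊢
    rw [div_pow, hx, hy, div_self hω0]
  · intro x hx
    simp only [Finset.mem_filter_univ] at hx ⊢
    rw [mul_pow, hx, hy, one_mul]
  · intro x _; field_simp
  · intro x _; field_simp

/-- Every value condition on `N`-th powers of nonzero elements is met `N` times as often as
on the `M`-th roots of unity, where `N * M = |F| - 1`. -/
theorem card_filter_pow_mem {N M : ℕ} (hNM : N * M = Fintype.card F - 1) (P : F → Prop)
    [DecidablePred P] :
    (Finset.univ.filter fun y : F => y ≠ 0 ∧ P (y ^ N)).card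
      = N * (Finset.univ.filter fun ω : F => ω ^ M = 1 ∧ P ω).card := by
  rw [mul_comm, Finset.card_eq_sum_card_fiberwise (f := fun y : F => y ^ N)
    (t := Finset.univ.filter fun ω : F => ω ^ M = 1 ∧ P ω)]
  · rw [Finset.sum_const_nat]
    intro ω hω
    simp only [Finset.mem_filter_univ] at hω
    refine Eq.trans (congrArg _ ?_) (card_filter_pow_eq hNM hω.1)
    rw [Finset.filter_filter]
    ext y
    simp only [Finset.mem_filter_univ]
    refine ⟨fun h => h.2, fun h => ⟨⟨?_, h ▸ hω.2⟩, h⟩⟩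
    rintro rfl
    have h0 : 0 < Fintype.card F - 1 := Nat.sub_pos_of_lt Fintype.one_lt_card
    have hN : N ≠ 0 := by rintro rfl; simp at hNM; omega
    have hM : M ≠ 0 := by rintro rfl; simp at hNM; omega
    rw [zero_pow hN] at h
    simp [← h, hM] at hω
  · intro y hy
    simp only [Finset.coe_filter, Set.mem_ofPred_eq, Finset.mem_univ, true_and] at hy ⊢
    exact ⟨by rw [← pow_mul, hNM, FiniteField.pow_card_sub_one_eq_one y hy.1], hy.2⟩

end FiniteFieldCounting

/-- The fibres of a surjective homomorphism of finite groups all have the same size. -/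
theorem card_fiber_mul_card {V W : Type*} [AddGroup V] [Fintype V] [AddGroup W] [Fintype W]
    [DecidableEq W] (f : V →+ W) (hf : Function.Surjective f) (w : W) :
    (Finset.univ.filter fun v => f v = w).card * Fintype.card W = Fintype.card V := by
  have h := Finset.card_eq_sum_card_fiberwise (f := f) (s := Finset.univ) (t := Finset.univ)
    (fun _ _ => Finset.mem_coe.2 (Finset.mem_univ _))
  rw [Finset.card_univ, Finset.sum_const_nat (m := (Finset.univ.filter fun v => f v = w).card)]
    at h
  · rw [h, mul_comm, Finset.card_univ]
  · intro x _
    exact AddMonoidHom.card_fiber_eq_of_mem_range f (hf x) (hf w)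

/-! ### Equidistribution of trace functionals -/

section Trace

variable {p : ℕ} [Fact p.Prime] {F : Type*} [Field F] [Algebra (ZMod p) F]

theorem card_fiber_mul {V : Type*} [AddCommGroup V] [Module (ZMod p) V] [Fintype V]
    (f : V →ₗ[ZMod p] ZMod p) (hf : f ≠ 0) (v : ZMod p) :
    (Finset.univ.filter fun x => f x = v).card * p = Fintype.card V := by
  have := card_fiber_mul_card f.toAddMonoidHom (LinearMap.surjective hf) v
  rw [ZMod.card] at this
  exact this

/-- The functional `x ↦ Tr (a x)`. -/
noncomputable def traceMul (p : ℕ) [Fact p.Prime] {F : Type*} [Field F] [Algebra (ZMod p) F] (a : F) :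
    F →ₗ[ZMod p] ZMod p :=
  Algebra.trace (ZMod p) F ∘ₗ LinearMap.mulLeft (ZMod p) a

theorem traceMul_apply (a x : F) : traceMul p a x = Algebra.trace (ZMod p) F (a * x) := rfl

variable [Fintype F]

theorem traceMul_ne_zero {a : F} (ha : a ≠ 0) : traceMul p a ≠ 0 := by
  intro h
  refine ha ((traceForm_nondegenerate (ZMod p) F).1 a fun b => ?_)
  rw [Algebra.traceForm_apply]
  exact LinearMap.congr_fun h b

theorem card_filter_trace_mul {a : F} (ha : a ≠ 0) (v : ZMod p) :
    (Finset.univ.filter fun x : F => Algebra.trace (ZMod p) F (a * x) = v).card * p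
      = Fintype.card F :=
  card_fiber_mul (traceMul p a) (traceMul_ne_zero ha) v

theorem card_filter_trace (v : ZMod p) :
    (Finset.univ.filter fun x : F => Algebra.trace (ZMod p) F x = v).card * p
      = Fintype.card F := by
  simpa using card_filter_trace_mul (F := F) one_ne_zero v

/-- If `γ` is not in the prime field, then `(Tr x, Tr (γ x))` is equidistributed. -/
theorem card_filter_trace_pair {γ : F} (hγ : γ ∉ Set.range (algebraMap (ZMod p) F))
    (a b : ZMod p) :
    (Finset.univ.filter fun x : F => Algebra.trace (ZMod p) F x = a ∧
      Algebra.trace (ZMod p) F (γ * x) = b).card * p ^ 2 = Fintype.card F := by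
  set f : F →ₗ[ZMod p] ZMod p × ZMod p := (Algebra.trace (ZMod p) F).prod (traceMul p γ) with hf
  -- If `x ↦ Tr (γ x)` vanished on the kernel of the trace, it would be `c • Tr` for some `c` in the
  -- prime field, and nondegeneracy would force `γ = c`.
  have hker : ∃ x, Algebra.trace (ZMod p) F x = 0 ∧ traceMul p γ x ≠ 0 := by
    by_contra! hcon
    have hmem : traceMul p γ ∈ Submodule.span (ZMod p) (Set.range fun _ : Unit =>
        Algebra.trace (ZMod p) F) := by
      refine mem_span_of_iInf_ker_le_ker fun x hx => ?_
      simp only [Submodule.mem_iInf, LinearMap.mem_ker] at hx ⊢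
      exact hcon x (hx ())
    rw [Set.range_const, Submodule.mem_span_singleton] at hmem
    obtain ⟨c, hc⟩ := hmem
    refine hγ ⟨c, ?_⟩
    by_contra hne
    refine traceMul_ne_zero (p := p) (sub_ne_zero.2 hne) (LinearMap.ext fun x => ?_)
    have := LinearMap.congr_fun hc x
    rw [LinearMap.smul_apply, traceMul_apply] at this
    rw [traceMul_apply, sub_mul, map_sub, ← this, ← Algebra.smul_def, map_smul]
    simp
  obtain ⟨x₁, h₁, h₁'⟩ := hker
  obtain ⟨x₂, h₂⟩ := LinearMap.surjective
    (show Algebra.trace (ZMod p) F ≠ 0 from Algebra.trace_ne_zero _ _) 1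
  have hsurj : Function.Surjective f := by
    rintro ⟨a, b⟩
    refine ⟨a • x₂ + ((b - a * traceMul p γ x₂) / traceMul p γ x₁) • x₁, ?_⟩
    ext
    · simp [hf, h₁, h₂]
    · simp [hf, h₁']
  have := card_fiber_mul_card f.toAddMonoidHom hsurj (a, b)
  rw [Fintype.card_prod, ZMod.card, ← sq] at this
  rw [← this]
  congr 2
  ext x
  simp [hf, traceMul_apply]

end Trace

/-! ### Traces of roots of unity as Ramanujan sums -/

section RootsOfUnity

theorem geom_sum_eq_zero_of_pow_eq_one {R : Type*} [CommRing R] [IsDomain R] {x : R} {n : ℕ}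
    (h1 : x ≠ 1) (hn : x ^ n = 1) : ∑ i ∈ Finset.range n, x ^ i = 0 := by
  have h := geom_sum_mul x n
  rw [hn, sub_self] at h
  exact (mul_eq_zero.1 h).resolve_right (sub_ne_zero.2 h1)

/-- If `p` is a primitive root modulo `m`, its first `φ m` powers run through all residues
prime to `m`. -/
theorem image_pow_mod_eq_filter_coprime {p m : ℕ} (hm : 1 < m)
    (hp : orderOf (p : ZMod m) = m.totient) :
    (Finset.range m.totient).image (fun i => p ^ i % m)
      = (Finset.range m).filter (fun a => m.Coprime a) := by
  have hpos : 0 < m.totient := Nat.totient_pos.2 (by omega)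
  have hunit : IsUnit (p : ZMod m) :=
    (isOfFinOrder_iff_pow_eq_one.2 ⟨_, hpos, hp ▸ pow_orderOf_eq_one _⟩).isUnit
  have hcop : p.Coprime m := (ZMod.isUnit_iff_coprime p m).1 hunit
  refine Finset.eq_of_subset_of_card_le (fun a ha => ?_) ?_
  · obtain ⟨i, -, rfl⟩ := Finset.mem_image.1 ha
    rw [Finset.mem_filter, Finset.mem_range]
    refine ⟨Nat.mod_lt _ (by omega), ?_⟩
    rw [Nat.coprime_iff_gcd_eq_one, Nat.gcd_comm, ← Nat.gcd_rec, Nat.gcd_comm]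
    exact (hcop.pow_left i)
  · rw [Finset.card_image_of_injOn, Finset.card_range, Nat.totient_eq_card_coprime]
    intro i hi j hj hij
    have hi' : i < orderOf (p : ZMod m) := by rw [hp]; simpa using hi
    have hj' : j < orderOf (p : ZMod m) := by rw [hp]; simpa using hj
    refine pow_injOn_Iio_orderOf hi' hj' ?_
    have := (ZMod.natCast_eq_natCast_iff' (p ^ i) (p ^ j) m).2 hij
    simpa using this

/-- The residues not prime to `l ^ (j + 1)` are the multiples of `l`. For `f a = ω ^ a` this turns a
Ramanujan sum into a difference of two geometric sums. -/
theorem sum_coprime_prime_pow {R : Type*} [CommRing R] {l j : ℕ} (hl : l.Prime) (f : ℕ → R) :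
    ∑ a ∈ (Finset.range (l ^ (j + 1))).filter (fun a => (l ^ (j + 1)).Coprime a), f a
      = ∑ a ∈ Finset.range (l ^ (j + 1)), f a - ∑ b ∈ Finset.range (l ^ j), f (l * b) := by
  rw [← Finset.sum_filter_add_sum_filter_not (Finset.range (l ^ (j + 1)))
    (fun a => (l ^ (j + 1)).Coprime a), eq_sub_iff_add_eq]
  congr 1
  have himage : (Finset.range (l ^ (j + 1))).filter (fun a => ¬ (l ^ (j + 1)).Coprime a)
      = (Finset.range (l ^ j)).image (fun b => l * b) := by
    ext a
    simp only [Finset.mem_filter, Finset.mem_range, Finset.mem_image,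
      Nat.coprime_pow_left_iff (Nat.succ_pos j), hl.coprime_iff_not_dvd, not_not]
    constructor
    · rintro ⟨ha, b, rfl⟩
      exact ⟨b, by rw [pow_succ'] at ha; exact lt_of_mul_lt_mul_left' ha, rfl⟩
    · rintro ⟨b, hb, rfl⟩
      exact ⟨by rw [pow_succ']; exact Nat.mul_lt_mul_of_pos_left hb hl.pos, dvd_mul_right _ _⟩
  rw [himage, Finset.sum_image]
  intro x _ y _ h
  exact Nat.eq_of_mul_eq_mul_left hl.pos h

variable {p : ℕ} [Fact p.Prime] {F : Type*} [Field F] [Fintype F] [Algebra (ZMod p) F]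

theorem finrank_eq_of_card_eq {e : ℕ} (hF : Fintype.card F = p ^ e) :
    Module.finrank (ZMod p) F = e := by
  have h := Module.card_eq_pow_finrank (K := ZMod p) (V := F)
  rw [hF, ZMod.card] at h
  exact (Nat.pow_right_injective (Fact.out : p.Prime).two_le h).symm

variable {l j : ℕ}

/-- The trace is the sum of the Frobenius conjugates `ω ^ p ^ i`. As `p` is a primitive root, the
exponents run once through the residues prime to `l ^ (j + 1)`. -/
theorem algebraMap_trace_of_pow_eq_one (hl : l.Prime)
    (hp : orderOf (p : ZMod (l ^ (j + 1))) = (l ^ (j + 1)).totient)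
    (hF : Fintype.card F = p ^ (l ^ (j + 1)).totient) {ω : F} (hω : ω ^ l ^ (j + 1) = 1) :
    algebraMap (ZMod p) F (Algebra.trace (ZMod p) F ω)
      = ∑ a ∈ Finset.range (l ^ (j + 1)), ω ^ a - ∑ b ∈ Finset.range (l ^ j), (ω ^ l) ^ b := by
  have hm : 1 < l ^ (j + 1) := Nat.one_lt_pow (Nat.succ_ne_zero j) hl.one_lt
  rw [FiniteField.algebraMap_trace_eq_sum_pow, finrank_eq_of_card_eq hF, Nat.card_zmod]
  simp_rw [← pow_mul]
  rw [← sum_coprime_prime_pow hl (fun a => ω ^ a), ← image_pow_mod_eq_filter_coprime hm hp,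
    Finset.sum_image]
  · refine Finset.sum_congr rfl fun i _ => ?_
    rw [← Nat.mod_add_div (p ^ i) (l ^ (j + 1)), pow_add, pow_mul ω (l ^ (j + 1)), hω, one_pow,
      mul_one, Nat.mod_add_div]
  -- Injectivity of `i ↦ p ^ i % l ^ (j + 1)` on the range follows because its image has the full
  -- size `φ (l ^ (j + 1))`.
  · refine Finset.card_image_iff.1 ?_
    rw [image_pow_mod_eq_filter_coprime hm hp, Finset.card_range, Nat.totient_eq_card_coprime]

/-- The first geometric sum vanishes, and the second consists of `l ^ j` ones. -/
theorem trace_eq_neg_of_pow_prime_eq_one (hl : l.Prime)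
    (hp : orderOf (p : ZMod (l ^ (j + 1))) = (l ^ (j + 1)).totient)
    (hF : Fintype.card F = p ^ (l ^ (j + 1)).totient) {ω : F} (hω : ω ^ l = 1) (h1 : ω ≠ 1) :
    Algebra.trace (ZMod p) F ω = -(l : ZMod p) ^ j := by
  have hω' : ω ^ l ^ (j + 1) = 1 := by rw [pow_succ', pow_mul, hω, one_pow]
  apply (algebraMap (ZMod p) F).injective
  rw [algebraMap_trace_of_pow_eq_one hl hp hF hω', geom_sum_eq_zero_of_pow_eq_one h1 hω', hω]
  simp

theorem trace_eq_zero_of_pow_prime_ne_one (hl : l.Prime)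
    (hp : orderOf (p : ZMod (l ^ (j + 1))) = (l ^ (j + 1)).totient)
    (hF : Fintype.card F = p ^ (l ^ (j + 1)).totient) {ω : F} (hω : ω ^ l ^ (j + 1) = 1)
    (h1 : ω ^ l ≠ 1) : Algebra.trace (ZMod p) F ω = 0 := by
  have h1' : ω ≠ 1 := by rintro rfl; simp at h1
  apply (algebraMap (ZMod p) F).injective
  rw [algebraMap_trace_of_pow_eq_one hl hp hF hω, geom_sum_eq_zero_of_pow_eq_one h1' hω,
    geom_sum_eq_zero_of_pow_eq_one h1 (by rw [← pow_mul, ← pow_succ', hω])]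
  simp

theorem trace_one_eq {e : ℕ} (hF : Fintype.card F = p ^ e) :
    Algebra.trace (ZMod p) F 1 = (e : ZMod p) := by
  have h := Algebra.trace_algebraMap (S := F) (1 : ZMod p)
  rw [map_one, finrank_eq_of_card_eq hF] at h
  simpa using h

variable [DecidableEq F]

/-- The roots split into `1`, the `l - 1` elements of order `l`, and the other `l ^ (j + 1) - l`,
with constant trace on each class. The three trace values may coincide modulo `p`, so the indicators
are added rather than treated as exclusive cases. -/
theorem card_filter_root_trace_eq (hl : l.Prime)
    (hp : orderOf (p : ZMod (l ^ (j + 1))) = (l ^ (j + 1)).totient)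
    (hF : Fintype.card F = p ^ (l ^ (j + 1)).totient)
    (hdvd : l ^ (j + 1) ∣ Fintype.card F - 1) (u : ZMod p) :
    (Finset.univ.filter fun ω : F => ω ^ l ^ (j + 1) = 1 ∧ Algebra.trace (ZMod p) F ω = u).card
      = (if u = ((l ^ (j + 1)).totient : ZMod p) then 1 else 0)
        + (if u = -(l : ZMod p) ^ j then l - 1 else 0)
        + (if u = 0 then l ^ (j + 1) - l else 0) := by
  set A := Finset.univ.filter fun ω : F => ω ^ l ^ (j + 1) = 1 with hA
  set B := Finset.univ.filter fun ω : F => ω ^ l = 1 with hB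
  have hAc : A.card = l ^ (j + 1) := card_filter_pow_eq_one hdvd
  have hBc : B.card = l :=
    card_filter_pow_eq_one ((dvd_pow_self l (Nat.succ_ne_zero j)).trans hdvd)
  have hBA : B ⊆ A := by
    intro ω hω
    simp only [hA, hB, Finset.mem_filter_univ] at hω ⊢
    rw [pow_succ', pow_mul, hω, one_pow]
  have h1B : (1 : F) ∈ B := by simp [hB]
  have hsum : ∀ ω ∈ A, (if Algebra.trace (ZMod p) F ω = u then 1 else 0)
      = if ω ∈ B then (if ω = 1 then (if u = ((l ^ (j + 1)).totient : ZMod p) then 1 else 0)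
          else (if u = -(l : ZMod p) ^ j then 1 else 0)) else (if u = 0 then 1 else 0) := by
    intro ω hω
    simp only [hA, Finset.mem_filter_univ] at hω
    by_cases h : ω ^ l = 1
    · rw [if_pos (show ω ∈ B by simpa [hB] using h)]
      by_cases h1 : ω = 1
      · rw [if_pos h1, h1, trace_one_eq hF]
        simp only [eq_comm]
      · rw [if_neg h1, trace_eq_neg_of_pow_prime_eq_one hl hp hF h h1]
        simp only [eq_comm]
    · rw [if_neg (show ω ∉ B by simpa [hB] using h),
        trace_eq_zero_of_pow_prime_ne_one hl hp hF hω h]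
      simp only [eq_comm]
  rw [← Finset.filter_filter, Finset.card_filter, Finset.sum_congr rfl hsum,
    ← Finset.sum_sdiff hBA, add_comm]
  congr 1
  · rw [Finset.sum_congr rfl (g := fun ω => if ω = 1
      then (if u = ((l ^ (j + 1)).totient : ZMod p) then 1 else 0)
      else (if u = -(l : ZMod p) ^ j then 1 else 0)) fun ω hω => if_pos hω,
      ← Finset.add_sum_erase _ _ h1B, if_pos rfl,
      Finset.sum_congr rfl (g := fun _ => if u = -(l : ZMod p) ^ j then 1 else 0)
        fun ω hω => if_neg (Finset.ne_of_mem_erase hω),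
      Finset.sum_const, Finset.card_erase_of_mem h1B, hBc]
    simp
  · rw [Finset.sum_congr rfl (g := fun _ => if u = 0 then 1 else 0)
      fun ω hω => if_neg (Finset.mem_sdiff.1 hω).2, Finset.sum_const,
      Finset.card_sdiff_of_subset hBA, hAc, hBc]
    simp

/-- For odd `m`, the `2m`-th roots of unity are the `m`-th roots of unity and their negatives. -/
theorem card_filter_two_mul_root_trace_eq (hp2 : p ≠ 2) {m : ℕ} (hm : Odd m) (u : ZMod p) :
    (Finset.univ.filter fun ω : F => ω ^ (2 * m) = 1 ∧ Algebra.trace (ZMod p) F ω = u).card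
      = (Finset.univ.filter fun ω : F => ω ^ m = 1 ∧ Algebra.trace (ZMod p) F ω = u).card
      + (Finset.univ.filter fun ω : F => ω ^ m = 1 ∧ Algebra.trace (ZMod p) F ω = -u).card := by
  have hchar : (1 : F) ≠ -1 := by
    intro h
    have h2 : algebraMap (ZMod p) F 1 = algebraMap (ZMod p) F (-1) := by simpa using h
    have : Fact (2 < p) := ⟨lt_of_le_of_ne (Fact.out : p.Prime).two_le (Ne.symm hp2)⟩
    exact ZMod.neg_one_ne_one ((algebraMap (ZMod p) F).injective h2).symm
  have hneg : (Finset.univ.filter fun ω : F => ω ^ m = -1 ∧ Algebra.trace (ZMod p) F ω = u).card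
      = (Finset.univ.filter fun ω : F => ω ^ m = 1 ∧ Algebra.trace (ZMod p) F ω = -u).card := by
    refine Finset.card_bij' (fun x _ => -x) (fun x _ => -x) ?_ ?_ ?_ ?_
    · intro x hx
      simp only [Finset.mem_filter_univ] at hx ⊢
      simp [hm.neg_pow, hx.1, hx.2]
    · intro x hx
      simp only [Finset.mem_filter_univ] at hx ⊢
      simp [hm.neg_pow, hx.1, hx.2]
    · simp
    · simp
  rw [← hneg, ← Finset.card_union_of_disjoint]
  · congr 1
    ext ω
    simp only [Finset.mem_filter_univ, Finset.mem_union, mul_comm 2 m, pow_mul, sq_eq_one_iff]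
    tauto
  · rw [Finset.disjoint_left]
    intro ω h h'
    simp only [Finset.mem_filter_univ] at h h'
    exact hchar (h.1.symm.trans h'.1)

end RootsOfUnity

/-! ### Lines over the subfield of index two -/

section LineCounting

theorem sub_one_dvd_card_sub_one {p s : ℕ} {F : Type*} [Fintype F]
    (hF : Fintype.card F = p ^ (2 * s)) :
    p ^ s - 1 ∣ Fintype.card F - 1 := by
  rw [hF, mul_comm, pow_mul]
  simpa using Nat.sub_dvd_pow_sub_pow (p ^ s) 1 2

variable {p : ℕ} [Fact p.Prime] {F : Type*} [Field F] [Algebra (ZMod p) F]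

/-- The elements of `F` fixed by the `s`-th power of Frobenius, as a subspace over the prime
field. -/
def frobeniusFixed (p : ℕ) [Fact p.Prime] (F : Type*) [Field F] [Algebra (ZMod p) F] (s : ℕ) :
    Submodule (ZMod p) F where
  carrier := {c | c ^ p ^ s = c}
  add_mem' {a b} ha hb := by
    have : CharP F p := charP_of_injective_algebraMap (algebraMap (ZMod p) F).injective p
    have : ExpChar F p := ExpChar.prime Fact.out
    change (a + b) ^ p ^ s = a + b
    rw [add_pow_expChar_pow, ha, hb]
  zero_mem' := zero_pow (pow_ne_zero _ (Fact.out : p.Prime).ne_zero)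
  smul_mem' a b hb := by
    change (a • b) ^ p ^ s = a • b
    rw [smul_pow, ZMod.pow_card_pow, hb]

theorem mem_frobeniusFixed {s : ℕ} {c : F} : c ∈ frobeniusFixed p F s ↔ c ^ p ^ s = c := Iff.rfl

theorem mem_frobeniusFixed_iff_pow_sub_one {s : ℕ} {c : F} (hc : c ≠ 0) :
    c ∈ frobeniusFixed p F s ↔ c ^ (p ^ s - 1) = 1 := by
  have hQ : p ^ s ≠ 0 := pow_ne_zero _ (Fact.out : p.Prime).ne_zero
  rw [mem_frobeniusFixed, ← pow_sub_one_mul hQ, mul_eq_right₀ hc]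

theorem mul_mem_frobeniusFixed {s : ℕ} {a b : F} (ha : a ∈ frobeniusFixed p F s)
    (hb : b ∈ frobeniusFixed p F s) : a * b ∈ frobeniusFixed p F s := by
  rw [mem_frobeniusFixed] at *
  rw [mul_pow, ha, hb]

variable [Fintype F] [DecidableEq F] {s : ℕ}

/-- Apart from `0`, the fixed elements are the `(p ^ s - 1)`-th roots of unity, and `p ^ s - 1`
divides `p ^ (2 * s) - 1`. -/
theorem card_frobeniusFixed (hF : Fintype.card F = p ^ (2 * s)) :
    Nat.card (frobeniusFixed p F s) = p ^ s := by
  have hs : p ^ s - 1 ≠ 0 := by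
    intro h
    have hd := sub_one_dvd_card_sub_one hF
    rw [h, zero_dvd_iff] at hd
    have := Fintype.one_lt_card (α := F)
    omega
  have hset : (frobeniusFixed p F s : Set F)
      = (insert 0 (Finset.univ.filter fun x : F => x ^ (p ^ s - 1) = 1) : Finset F) := by
    ext c
    by_cases hc : c = 0
    · simp [hc]
    · simp [hc, mem_frobeniusFixed_iff_pow_sub_one hc]
  change Nat.card (frobeniusFixed p F s : Set F) = _
  rw [hset, Nat.card_coe_set_eq, Set.ncard_coe_finset, Finset.card_insert_of_notMem,
    card_filter_pow_eq_one (sub_one_dvd_card_sub_one hF)]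
  · omega
  · simp [hs]

theorem finrank_frobeniusFixed (hF : Fintype.card F = p ^ (2 * s)) :
    Module.finrank (ZMod p) (frobeniusFixed p F s) = s := by
  have h := Module.natCard_eq_pow_finrank (K := ZMod p) (V := frobeniusFixed p F s)
  rw [card_frobeniusFixed hF, Nat.card_zmod] at h
  exact (Nat.pow_right_injective (Fact.out : p.Prime).two_le h).symm

/-- The functional `c ↦ Tr (z c)` on the subfield of index two vanishes exactly for `z` on one
line over that subfield. -/
theorem exists_forall_trace_mul_eq_zero_iff (hF : Fintype.card F = p ^ (2 * s)) :
    ∃ z₀ : F, z₀ ≠ 0 ∧ ∀ z : F,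
      (∀ c ∈ frobeniusFixed p F s, Algebra.trace (ZMod p) F (z * c) = 0)
        ↔ z / z₀ ∈ frobeniusFixed p F s := by
  set K := frobeniusFixed p F s
  set W := (Algebra.traceForm (ZMod p) F).orthogonal K with hW
  have hs : s ≠ 0 := by
    rintro rfl
    have := Fintype.one_lt_card (α := F)
    simp [hF] at this
  have hWmem : ∀ z, z ∈ W ↔ ∀ c ∈ K, Algebra.trace (ZMod p) F (z * c) = 0 := by
    intro z
    rw [hW, LinearMap.BilinForm.mem_orthogonal_iff]
    refine forall₂_congr fun c _ => ?_
    rw [Algebra.traceForm_apply, mul_comm]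
  -- The orthogonal complement of the `s`-dimensional `K` in the `2 * s`-dimensional `F` again has
  -- dimension `s`.
  have hWrank : Module.finrank (ZMod p) W = s := by
    rw [hW, LinearMap.BilinForm.finrank_orthogonal (traceForm_nondegenerate _ _),
      finrank_frobeniusFixed hF, finrank_eq_of_card_eq hF]
    omega
  have hWcard : Nat.card W = p ^ s := by
    rw [Module.natCard_eq_pow_finrank (K := ZMod p), hWrank, Nat.card_zmod]
  have hWne : W ≠ ⊥ := by
    intro h
    rw [h, finrank_bot] at hWrank
    exact hs hWrank.symm
  obtain ⟨z₀, hz₀W, hz₀⟩ := Submodule.exists_mem_ne_zero_of_ne_bot hWne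
  refine ⟨z₀, hz₀, fun z => ?_⟩
  rw [← hWmem]
  -- `W` is stable under `K` because `K` is closed under multiplication. As `W` and `K` have equal
  -- size, `W` is the line `K z₀`.
  have hmul : ∀ c ∈ K, c * z₀ ∈ W := by
    intro c hc
    rw [hWmem] at hz₀W ⊢
    intro d hd
    rw [mul_comm c, mul_assoc]
    exact hz₀W _ (mul_mem_frobeniusFixed hc hd)
  let g : K → W := fun c => ⟨c * z₀, hmul c c.2⟩
  have hg : Function.Bijective g := by
    refine (Nat.bijective_iff_injective_and_card g).2 ⟨fun c d hcd => ?_, ?_⟩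
    · exact Subtype.ext (mul_right_cancel₀ hz₀ (congrArg Subtype.val hcd))
    · rw [card_frobeniusFixed hF, hWcard]
  constructor
  · intro hz
    obtain ⟨c, hc⟩ := hg.2 ⟨z, hz⟩
    have : (c : F) * z₀ = z := congrArg Subtype.val hc
    rw [← this, mul_div_cancel_right₀ _ hz₀]
    exact c.2
  · intro hz
    have := hmul _ hz
    rwa [div_mul_cancel₀ _ hz₀] at this

/-- A nonzero functional on `K` has fibres of size `|K| / p`. Writing the exponent as `s' + 1`
avoids this division. -/
theorem card_filter_frobeniusFixed_trace_mul {s' : ℕ} (hF : Fintype.card F = p ^ (2 * (s' + 1)))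
    {z : F} (hz : ¬ ∀ c ∈ frobeniusFixed p F (s' + 1), Algebra.trace (ZMod p) F (z * c) = 0)
    (v : ZMod p) :
    (Finset.univ.filter fun c : F => c ^ p ^ (s' + 1) = c ∧
      Algebra.trace (ZMod p) F (z * c) = v).card = p ^ s' := by
  classical
  set K := frobeniusFixed p F (s' + 1)
  let φ : K →ₗ[ZMod p] ZMod p := traceMul p z ∘ₗ K.subtype
  have hφ : φ ≠ 0 := by
    intro h
    exact hz fun c hc => LinearMap.congr_fun h ⟨c, hc⟩
  have : Fintype K := Fintype.ofFinite K
  have h := card_fiber_mul φ hφ v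
  rw [← Nat.card_eq_fintype_card, card_frobeniusFixed hF, pow_succ] at h
  refine Eq.trans ?_ (Nat.eq_of_mul_eq_mul_right (Fact.out : p.Prime).pos h)
  refine Finset.card_bij' (fun c hc => ⟨c, (Finset.mem_filter.1 hc).2.1⟩) (fun c _ => c) ?_ ?_
    ?_ ?_
  · intro c hc
    simp only [Finset.mem_filter_univ] at hc ⊢
    exact hc.2
  · intro c hc
    simp only [Finset.mem_filter_univ] at hc ⊢
    exact ⟨c.2, hc⟩
  · intro c _; rfl
  · intro c _; rfl

/-- The number of units `c` of the subfield of index two with `Tr (z c) = v`. -/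
theorem card_filter_units_trace_mul {s' : ℕ} (hF : Fintype.card F = p ^ (2 * (s' + 1)))
    (z : F) (v : ZMod p) [Decidable (∀ c ∈ frobeniusFixed p F (s' + 1),
      Algebra.trace (ZMod p) F (z * c) = 0)] :
    ((Finset.univ.filter fun c : F => c ^ (p ^ (s' + 1) - 1) = 1 ∧
      Algebra.trace (ZMod p) F (z * c) = v).card : ℤ)
      = (p : ℤ) ^ s' - (if v = 0 then 1 else 0)
        + (if ∀ c ∈ frobeniusFixed p F (s' + 1), Algebra.trace (ZMod p) F (z * c) = 0
          then (if v = 0 then (p : ℤ) ^ (s' + 1) else 0) - (p : ℤ) ^ s' else 0) := by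
  have hp1 : 1 < p ^ (s' + 1) := Nat.one_lt_pow (Nat.succ_ne_zero s') (Fact.out : p.Prime).one_lt
  split_ifs with hv hz hz
  · have : (Finset.univ.filter fun c : F => c ^ (p ^ (s' + 1) - 1) = 1 ∧
        Algebra.trace (ZMod p) F (z * c) = v)
        = Finset.univ.filter fun c : F => c ^ (p ^ (s' + 1) - 1) = 1 := by
      ext c
      simp only [Finset.mem_filter_univ, and_iff_left_iff_imp]
      intro hc
      have hc0 : c ≠ 0 := by rintro rfl; rw [zero_pow (by omega)] at hc; simp at hc
      rw [hv]
      exact hz c ((mem_frobeniusFixed_iff_pow_sub_one hc0).2 hc)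
    rw [this, card_filter_pow_eq_one (sub_one_dvd_card_sub_one hF), Nat.cast_sub hp1.le]
    push_cast
    ring
  · have h := card_filter_frobeniusFixed_trace_mul hF hz v
    have h2 : (Finset.univ.filter fun c : F => c ^ p ^ (s' + 1) = c ∧
        Algebra.trace (ZMod p) F (z * c) = v)
        = insert 0 (Finset.univ.filter fun c : F => c ^ (p ^ (s' + 1) - 1) = 1 ∧
          Algebra.trace (ZMod p) F (z * c) = v) := by
      ext c
      by_cases hc : c = 0
      · simp [hc, hv, (Fact.out : p.Prime).ne_zero]
      · simp [hc, ← mem_frobeniusFixed_iff_pow_sub_one hc, mem_frobeniusFixed]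
    rw [h2, Finset.card_insert_of_notMem (by simp [zero_pow (show p ^ (s' + 1) - 1 ≠ 0 by omega)])]
      at h
    have h' : ((p ^ s' : ℕ) : ℤ) = (p : ℤ) ^ s' := by push_cast; rfl
    rw [← h', ← h]
    push_cast
    ring
  · rw [Finset.card_eq_zero.2]
    · simp
    · rw [Finset.filter_eq_empty_iff]
      rintro c - ⟨hc, hcv⟩
      have hc0 : c ≠ 0 := by rintro rfl; rw [zero_pow (by omega)] at hc; simp at hc
      exact hv (hcv.symm.trans (hz c ((mem_frobeniusFixed_iff_pow_sub_one hc0).2 hc)))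
  · have h := card_filter_frobeniusFixed_trace_mul hF hz v
    have h2 : (Finset.univ.filter fun c : F => c ^ p ^ (s' + 1) = c ∧
        Algebra.trace (ZMod p) F (z * c) = v)
        = (Finset.univ.filter fun c : F => c ^ (p ^ (s' + 1) - 1) = 1 ∧
          Algebra.trace (ZMod p) F (z * c) = v) := by
      ext c
      by_cases hc : c = 0
      · simp [hc, Ne.symm hv]
      · simp [← mem_frobeniusFixed_iff_pow_sub_one hc, mem_frobeniusFixed]
    rw [← h2, h]
    simp

/-- A function constant on the lines over the subfield of index two agrees with a translated
trace functional `u + Tr (δ y)` equally often for all `δ ≠ 0`, up to the contribution of one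
line. -/
theorem exists_card_filter_sub_trace_mul {s' : ℕ} (hF : Fintype.card F = p ^ (2 * (s' + 1))) :
    ∃ z₀ : F, z₀ ≠ 0 ∧ ∀ (f : F → ZMod p)
      (_ : ∀ c y, c ^ (p ^ (s' + 1) - 1) = 1 → f (c * y) = f y) (δ : F) (_ : δ ≠ 0) (u : ZMod p),
      ((p : ℤ) ^ (s' + 1) - 1) * (Finset.univ.filter fun y : F => y ≠ 0 ∧
          f y - Algebra.trace (ZMod p) F (δ * y) = u).card
        = ((p : ℤ) ^ (2 * (s' + 1)) - 1) * (p : ℤ) ^ s'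
          - (Finset.univ.filter fun y : F => y ≠ 0 ∧ f y = u).card
          + ((p : ℤ) ^ (s' + 1) - 1)
            * ((if f (z₀ / δ) = u then (p : ℤ) ^ (s' + 1) else 0) - (p : ℤ) ^ s') := by
  classical
  obtain ⟨z₀, hz₀, hW⟩ := exists_forall_trace_mul_eq_zero_iff (p := p) hF
  refine ⟨z₀, hz₀, fun f hf δ hδ u => ?_⟩
  have hp1 : 1 < p ^ (s' + 1) := Nat.one_lt_pow (Nat.succ_ne_zero s') (Fact.out : p.Prime).one_lt
  set E := Finset.univ.filter fun c : F => c ^ (p ^ (s' + 1) - 1) = 1 with hE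
  have hEc : (E.card : ℤ) = (p : ℤ) ^ (s' + 1) - 1 := by
    rw [hE, card_filter_pow_eq_one (sub_one_dvd_card_sub_one hF), Nat.cast_sub hp1.le]
    push_cast
    rfl
  have hE0 : ∀ c ∈ E, c ≠ 0 := by
    rintro c hc rfl
    rw [hE, Finset.mem_filter_univ, zero_pow (by omega)] at hc
    simp at hc
  set Y := Finset.univ.filter fun y : F => y ≠ 0 with hY
  have hYc : (Y.card : ℤ) = (p : ℤ) ^ (2 * (s' + 1)) - 1 := by
    have h1 : 1 ≤ p ^ (2 * (s' + 1)) := Nat.one_le_pow _ _ (Fact.out : p.Prime).pos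
    rw [hY, Finset.filter_ne', Finset.card_erase_of_mem (Finset.mem_univ _), Finset.card_univ, hF,
      Nat.cast_sub h1]
    push_cast
    rfl
  -- Substituting `c * y` for `y` does not change `f`, so each unit `c` of the subfield gives the
  -- same count. Summing over `c` multiplies it by `p ^ (s' + 1) - 1`.
  have hscale : ∀ c ∈ E, ((Finset.univ.filter fun y : F => y ≠ 0 ∧
      f y - Algebra.trace (ZMod p) F (δ * y) = u).card : ℤ)
      = ∑ y ∈ Y, if Algebra.trace (ZMod p) F (δ * y * c) = f y - u then (1 : ℤ) else 0 := by
    intro c hc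
    have hc0 := hE0 c hc
    rw [hE, Finset.mem_filter_univ] at hc
    rw [← Finset.natCast_card_filter, hY, Finset.filter_filter, Nat.cast_inj]
    refine Finset.card_bij' (fun y _ => y / c) (fun y _ => c * y) ?_ ?_ ?_ ?_
    · intro y hy
      simp only [Finset.mem_filter_univ] at hy ⊢
      have h := hf c (y / c) hc
      rw [mul_div_cancel₀ _ hc0] at h
      rw [← h, mul_assoc, div_mul_cancel₀ _ hc0]
      exact ⟨div_ne_zero hy.1 hc0, by rw [← hy.2]; ring⟩
    · intro y hy
      simp only [Finset.mem_filter_univ] at hy ⊢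
      refine ⟨mul_ne_zero hc0 hy.1, ?_⟩
      rw [hf c y hc, show δ * (c * y) = δ * y * c by ring, hy.2]
      ring
    · intro y _; field_simp
    · intro y _; field_simp
  -- For fixed `y` this counts units `c` with prescribed `Tr (δ y c)`. On the exceptional line `δ y
  -- / z₀` is such a unit, so `f y = f (z₀ / δ)` and the correction does not depend on `y`.
  have hinner : ∀ y ∈ Y, (∑ c ∈ E, if Algebra.trace (ZMod p) F (δ * y * c) = f y - u
      then (1 : ℤ) else 0) = (p : ℤ) ^ s' - (if f y = u then 1 else 0)
        + (if δ * y / z₀ ∈ frobeniusFixed p F (s' + 1)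
          then (if f (z₀ / δ) = u then (p : ℤ) ^ (s' + 1) else 0) - (p : ℤ) ^ s' else 0) := by
    intro y hy
    rw [hY, Finset.mem_filter_univ] at hy
    rw [← Finset.natCast_card_filter, hE, Finset.filter_filter,
      card_filter_units_trace_mul hF (δ * y) (f y - u)]
    simp only [hW, sub_eq_zero]
    congr 1
    refine if_ctx_congr Iff.rfl (fun h => ?_) fun _ => rfl
    rw [mem_frobeniusFixed_iff_pow_sub_one (div_ne_zero (mul_ne_zero hδ hy) hz₀)] at h
    rw [← hf _ (z₀ / δ) h, show δ * y / z₀ * (z₀ / δ) = y by field_simp]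
  have hline : ((Y.filter fun y => δ * y / z₀ ∈ frobeniusFixed p F (s' + 1)).card : ℤ)
      = (p : ℤ) ^ (s' + 1) - 1 := by
    rw [← hEc, Nat.cast_inj]
    refine Finset.card_bij' (fun y _ => δ * y / z₀) (fun c _ => c * z₀ / δ) ?_ ?_ ?_ ?_
    · intro y hy
      simp only [hY, Finset.filter_filter, Finset.mem_filter_univ] at hy
      rw [hE, Finset.mem_filter_univ]
      exact (mem_frobeniusFixed_iff_pow_sub_one (div_ne_zero (mul_ne_zero hδ hy.1) hz₀)).1 hy.2
    · intro c hc
      have hc0 := hE0 c hc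
      rw [hE, Finset.mem_filter_univ] at hc
      simp only [hY, Finset.filter_filter, Finset.mem_filter_univ]
      refine ⟨div_ne_zero (mul_ne_zero hc0 hz₀) hδ, ?_⟩
      rw [show δ * (c * z₀ / δ) / z₀ = c by field_simp]
      exact (mem_frobeniusFixed_iff_pow_sub_one hc0).2 hc
    · intro y _; field_simp
    · intro y _; field_simp
  have hcount : ((p : ℤ) ^ (s' + 1) - 1) * (Finset.univ.filter fun y : F => y ≠ 0 ∧
      f y - Algebra.trace (ZMod p) F (δ * y) = u).card
      = ∑ y ∈ Y, ∑ c ∈ E, if Algebra.trace (ZMod p) F (δ * y * c) = f y - u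
        then (1 : ℤ) else 0 := by
    rw [Finset.sum_comm, ← Finset.sum_congr rfl hscale, Finset.sum_const, nsmul_eq_mul, hEc]
  rw [hcount, Finset.sum_congr rfl hinner, Finset.sum_add_distrib, Finset.sum_sub_distrib,
    Finset.sum_const, nsmul_eq_mul, hYc, ← Finset.natCast_card_filter, ← Finset.sum_filter,
    Finset.sum_const, nsmul_eq_mul, hline, hY, Finset.filter_filter]

end LineCounting

/-! ### Weights of individual codewords -/

section Weights

theorem codeword_apply {p : ℕ} {F : Type*} [Field F] [Algebra (ZMod p) F] (D : Finset (F × F))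
    (g : F × F) (d : D) :
    codeword p D g d
      = Algebra.trace (ZMod p) F (g.1 * d.1.1) + Algebra.trace (ZMod p) F (g.2 * d.1.2) :=
  map_add (Algebra.trace (ZMod p) F) _ _

variable {p : ℕ} [Fact p.Prime] {F : Type*} [Field F] [Fintype F] [Algebra (ZMod p) F]

theorem card_filter_trace_eq_pow {e : ℕ} (hF : Fintype.card F = p ^ (e + 1)) (v : ZMod p) :
    (Finset.univ.filter fun x : F => Algebra.trace (ZMod p) F x = v).card = p ^ e := by
  have h := card_filter_trace (F := F) v
  rw [hF, pow_succ] at h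
  exact Nat.eq_of_mul_eq_mul_right (Fact.out : p.Prime).pos h

theorem card_filter_prod_eq_sum {α β : Type*} [Fintype α] [Fintype β] (P : α × β → Prop)
    [DecidablePred P] :
    (Finset.univ.filter P).card
      = ∑ b : β, (Finset.univ.filter fun a : α => P (a, b)).card := by
  simp only [Finset.card_filter, Fintype.sum_prod_type_right]

theorem card_filter_trace_add {e : ℕ} (hF : Fintype.card F = p ^ (e + 1)) (f : F → ZMod p)
    (u : ZMod p) :
    (Finset.univ.filter fun z : F × F => Algebra.trace (ZMod p) F z.1 + f z.2 = u).card
      = p ^ (2 * e + 1) := by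
  rw [card_filter_prod_eq_sum, Finset.sum_const_nat (m := p ^ e), Finset.card_univ, hF]
  · ring
  · intro y _
    simp only [← eq_sub_iff_add_eq, card_filter_trace_eq_pow hF]

/-- For each `y` the pair `(Tr x, Tr (γ x))` is equidistributed, so `p ^ (e + 1) - p ^ e` values of
`x` qualify, whatever `f` and `g` are. -/
theorem weight_of_notMem_range {e : ℕ} (hF : Fintype.card F = p ^ (e + 2)) (f g : F → ZMod p)
    (u : ZMod p) {γ : F} (hγ : γ ∉ Set.range (algebraMap (ZMod p) F)) :
    (Finset.univ.filter fun z : F × F => Algebra.trace (ZMod p) F z.1 + f z.2 = u ∧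
      Algebra.trace (ZMod p) F (γ * z.1) + g z.2 ≠ 0).card
      = p ^ (e + 1) * (p ^ (e + 2) - p ^ (e + 1)) := by
  rw [card_filter_prod_eq_sum, Finset.sum_const_nat (m := p ^ (e + 1) - p ^ e), Finset.card_univ,
    hF, Nat.mul_sub, Nat.mul_sub]
  · congr 1 <;> ring
  · intro y _
    have h1 := card_filter_trace_eq_pow (e := e + 1) hF (u - f y)
    have h2 : (Finset.univ.filter fun x : F => Algebra.trace (ZMod p) F x = u - f y ∧
        Algebra.trace (ZMod p) F (γ * x) = -g y).card = p ^ e := by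
      have h := card_filter_trace_pair hγ (u - f y) (-g y)
      rw [hF, pow_add] at h
      exact Nat.eq_of_mul_eq_mul_right (pow_pos (Fact.out : p.Prime).pos 2) h
    rw [← h1, ← h2, ← Finset.filter_filter, ← Finset.filter_filter]
    simp only [← eq_sub_iff_add_eq, zero_sub, ne_eq]
    have h := Finset.card_filter_add_card_filter_not
      (s := Finset.univ.filter fun x : F => Algebra.trace (ZMod p) F x = u - f y)
      (fun x => Algebra.trace (ZMod p) F (γ * x) = -g y)
    omega

/-- On the fibre over `y` one has `Tr (c x) = c * Tr x = c * (u - f y)`, so the second condition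
depends on `y` only and each good `y` contributes all `p ^ e` values of `x`. -/
theorem weight_of_algebraMap {e : ℕ} (hF : Fintype.card F = p ^ (e + 1)) (f g : F → ZMod p)
    (u c : ZMod p) :
    (Finset.univ.filter fun z : F × F => Algebra.trace (ZMod p) F z.1 + f z.2 = u ∧
      Algebra.trace (ZMod p) F (algebraMap (ZMod p) F c * z.1) + g z.2 ≠ 0).card
      = p ^ e * (Finset.univ.filter fun y : F => c * (u - f y) + g y ≠ 0).card := by
  rw [card_filter_prod_eq_sum, Finset.card_filter, Finset.mul_sum]
  refine Finset.sum_congr rfl fun y _ => ?_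
  simp only [← Algebra.smul_def, map_smul, smul_eq_mul]
  split_ifs with h
  · rw [mul_one, ← card_filter_trace_eq_pow hF (u - f y)]
    congr 1
    ext x
    rw [Finset.mem_filter_univ, Finset.mem_filter_univ, ← eq_sub_iff_add_eq]
    refine ⟨fun hx => hx.1, fun hx => ⟨hx, ?_⟩⟩
    rwa [hx]
  · rw [mul_zero, Finset.card_eq_zero, Finset.filter_eq_empty_iff]
    rintro x - ⟨hx, hx'⟩
    rw [eq_sub_of_add_eq hx] at hx'
    exact h hx'

variable [DecidableEq F]

/-- The weight of the word of `(γ, δ)`, counted over all points of the plane: the origin never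
contributes. -/
theorem hammingNorm_codeword {N : ℕ} (u : ZMod p) (γ δ : F) :
    hammingNorm (codeword p (definingSet p F N u) (γ, δ))
      = (Finset.univ.filter fun z : F × F =>
          Algebra.trace (ZMod p) F z.1 + Algebra.trace (ZMod p) F (z.2 ^ N) = u ∧
          Algebra.trace (ZMod p) F (γ * z.1) + Algebra.trace (ZMod p) F (δ * z.2) ≠ 0).card := by
  unfold hammingNorm
  refine Finset.card_bij (fun z _ => z.1) ?_ ?_ ?_
  · rintro ⟨z, hz⟩ h
    rw [Finset.mem_filter_univ, codeword_apply] at h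
    simp only [definingSet, Finset.mem_filter_univ, map_add] at hz ⊢
    exact ⟨hz.2, h⟩
  · intro a _ b _ h
    exact Subtype.ext h
  · intro z hz
    simp only [Finset.mem_filter_univ] at hz
    have hne : z ≠ (0, 0) := by rintro rfl; simp at hz
    refine ⟨⟨z, by simp [definingSet, hne, hz.1]⟩, ?_, rfl⟩
    rw [Finset.mem_filter_univ, codeword_apply]
    exact hz.2

variable {s M r N : ℕ} {u : ZMod p}

/-- How often `Tr (y ^ N)` avoids `u + Tr (δ y)`, for `δ ≠ 0`, in terms of the number `n` of
`M`-th roots of unity of trace `u`. -/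
theorem exists_card_filter_pow_trace_ne (hF : Fintype.card F = p ^ (2 * (s + 1)))
    (hM : M * r = p ^ (s + 1) + 1) (hN : N = (p ^ (s + 1) - 1) * r) {n : ℕ}
    (hn : (Finset.univ.filter fun ω : F => ω ^ M = 1 ∧ Algebra.trace (ZMod p) F ω = u).card = n) :
    ∃ z₀ : F, z₀ ≠ 0 ∧ ∀ δ : F, δ ≠ 0 →
      ((Finset.univ.filter fun y : F =>
        Algebra.trace (ZMod p) F (y ^ N) - Algebra.trace (ZMod p) F (δ * y) ≠ u).card : ℤ)
      + (if u = 0 then 1 else 0)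
      + (if Algebra.trace (ZMod p) F ((z₀ / δ) ^ N) = u then (p : ℤ) ^ (s + 1) else 0)
      = p ^ (2 * s + 2) - p ^ (2 * s + 1) + n * r := by
  have hp1 : 1 < p ^ (s + 1) := Nat.one_lt_pow (Nat.succ_ne_zero s) (Fact.out : p.Prime).one_lt
  have hr : r ≠ 0 := by rintro rfl; simp at hM
  have hN0 : N ≠ 0 := by rw [hN]; exact mul_ne_zero (by omega) hr
  have hNM : N * M = Fintype.card F - 1 := by
    rw [hN, hF, mul_assoc, mul_comm r, hM, mul_comm, ← Nat.sq_sub_sq (p ^ (s + 1)) 1]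
    rw [← pow_mul, mul_comm 2, one_pow]
  obtain ⟨z₀, hz₀, h⟩ := exists_card_filter_sub_trace_mul (p := p) hF
  refine ⟨z₀, hz₀, fun δ hδ => ?_⟩
  have hX := h (fun y => Algebra.trace (ZMod p) F (y ^ N)) (fun c y hc => by
    rw [mul_pow, hN, pow_mul c, hc, one_pow, one_mul]) δ hδ u
  rw [card_filter_pow_mem hNM (fun x => Algebra.trace (ZMod p) F x = u), hn, hN, Nat.cast_mul,
    Nat.cast_mul, Nat.cast_sub hp1.le, ← hN] at hX
  set X := (Finset.univ.filter fun y : F => y ≠ 0 ∧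
    Algebra.trace (ZMod p) F (y ^ N) - Algebra.trace (ZMod p) F (δ * y) = u).card
  have hcompl := Finset.card_filter_add_card_filter_not (s := (Finset.univ : Finset F))
    (fun y => Algebra.trace (ZMod p) F (y ^ N) - Algebra.trace (ZMod p) F (δ * y) = u)
  have hzero : (Finset.univ.filter fun y : F =>
      Algebra.trace (ZMod p) F (y ^ N) - Algebra.trace (ZMod p) F (δ * y) = u).card
      = X + if u = 0 then 1 else 0 := by
    rw [Finset.card_filter, ← Finset.add_sum_erase _ _ (Finset.mem_univ 0), add_comm,
      ← Finset.card_filter]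
    congr 1
    · congr 1
      ext y
      simp
    · simp [hN0, eq_comm]
  rw [hzero, Finset.card_univ, hF] at hcompl
  have hcompl' := congrArg (Nat.cast : ℕ → ℤ) hcompl
  push_cast at hcompl' hX
  have hQ : ((p : ℤ) ^ (s + 1) - 1) ≠ 0 := by
    have : (1 : ℤ) < (p : ℤ) ^ (s + 1) := by exact_mod_cast hp1
    omega
  set κ : ℤ := if Algebra.trace (ZMod p) F ((z₀ / δ) ^ N) = u then (p : ℤ) ^ (s + 1) else 0
  -- With `Q = p ^ (s + 1)`, division by `Q - 1` turns `(Q ^ 2 - 1) * p ^ s` into `(Q + 1) * p ^ s`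
  -- and `n * N` into `n * r`. The term `-p ^ s` of the exceptional line leaves `Q * p ^ s = p ^ (2
  -- * s + 1)`.
  have hX' : (X : ℤ) = p ^ (2 * s + 1) - n * r + κ := by
    apply mul_left_cancel₀ hQ
    rw [hX]
    ring
  rw [hX'] at hcompl'
  simp only [ne_eq]
  linear_combination hcompl'

/-- The number of words of each weight among the multiples `(c, δ)` of a fixed `c ≠ 0` in the
prime field. -/
theorem sum_weight_indicator (hF : Fintype.card F = p ^ (2 * (s + 1)))
    (hM : M * r = p ^ (s + 1) + 1) (hN : N = (p ^ (s + 1) - 1) * r) {n : ℕ}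
    (hn : (Finset.univ.filter fun ω : F => ω ^ M = 1 ∧ Algebra.trace (ZMod p) F ω = u).card = n)
    {a₁ a₂ a₃ : ℕ}
    (h₁ : a₁ + (if u = 0 then 1 else 0) + n * N = p ^ (2 * s + 2))
    (h₂ : a₂ + (if u = 0 then 1 else 0) + p ^ (s + 1) + p ^ (2 * s + 1)
      = p ^ (2 * s + 2) + n * r)
    (h₃ : a₃ + (if u = 0 then 1 else 0) + p ^ (2 * s + 1) = p ^ (2 * s + 2) + n * r)
    (G : ℕ → ℕ) :
    ∑ δ : F, G (Finset.univ.filter fun y : F =>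
        Algebra.trace (ZMod p) F (y ^ N) - Algebra.trace (ZMod p) F (δ * y) ≠ u).card
      = G a₁ + n * N * G a₂ + (M - n) * N * G a₃ := by
  have hp1 : 1 < p ^ (s + 1) := Nat.one_lt_pow (Nat.succ_ne_zero s) (Fact.out : p.Prime).one_lt
  have hr : r ≠ 0 := by rintro rfl; simp at hM
  have hN0 : N ≠ 0 := by rw [hN]; exact mul_ne_zero (by omega) hr
  have hNM : N * M = Fintype.card F - 1 := by
    rw [hN, hF, mul_assoc, mul_comm r, hM, mul_comm, ← Nat.sq_sub_sq (p ^ (s + 1)) 1]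
    rw [← pow_mul, mul_comm 2, one_pow]
  have hB := card_filter_pow_mem hNM (fun x : F => Algebra.trace (ZMod p) F x = u)
  rw [hn] at hB
  obtain ⟨z₀, hz₀, h⟩ := exists_card_filter_pow_trace_ne hF hM hN hn
  rw [← Finset.add_sum_erase _ _ (Finset.mem_univ 0), add_assoc]
  congr 1
  · congr 1
    have hcompl := Finset.card_filter_add_card_filter_not (s := (Finset.univ : Finset F))
      (fun y => Algebra.trace (ZMod p) F (y ^ N) = u)
    have hzero : (Finset.univ.filter fun y : F => Algebra.trace (ZMod p) F (y ^ N) = u).card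
        = N * n + if u = 0 then 1 else 0 := by
      rw [Finset.card_filter, ← Finset.add_sum_erase _ _ (Finset.mem_univ 0), add_comm,
        ← Finset.card_filter, ← hB]
      congr 1
      · congr 1
        ext y
        simp
      · simp [hN0, eq_comm]
    rw [hzero, Finset.card_univ, hF] at hcompl
    simp only [zero_mul, map_zero, sub_zero, ne_eq]
    have : p ^ (2 * s + 2) = p ^ (2 * (s + 1)) := by ring
    rw [this, mul_comm n] at h₁
    omega
  · have hval : ∀ δ ∈ Finset.univ.erase (0 : F), G (Finset.univ.filter fun y : F =>
        Algebra.trace (ZMod p) F (y ^ N) - Algebra.trace (ZMod p) F (δ * y) ≠ u).card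
        = if Algebra.trace (ZMod p) F ((z₀ / δ) ^ N) = u then G a₂ else G a₃ := by
      intro δ hδ
      have hδ' := h δ (Finset.ne_of_mem_erase hδ)
      have hQ : ((p ^ (s + 1) : ℕ) : ℤ) = (p : ℤ) ^ (s + 1) := by push_cast; rfl
      have hP : ((p ^ (2 * s + 1) : ℕ) : ℤ) = (p : ℤ) ^ (2 * s + 1) := by push_cast; rfl
      have hq : ((p ^ (2 * s + 2) : ℕ) : ℤ) = (p : ℤ) ^ (2 * s + 2) := by push_cast; rfl
      rw [← hQ, ← hP, ← hq, ← Nat.cast_mul] at hδ'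
      split_ifs at hδ' h₁ h₂ h₃ ⊢ <;> congr 1 <;> omega
    rw [Finset.sum_congr rfl hval, Finset.sum_ite, Finset.sum_const, Finset.sum_const,
      smul_eq_mul, smul_eq_mul]
    -- The involution `δ ↦ z₀ / δ` of the units identifies the exceptional `δ` with the nonzero `y`
    -- satisfying `Tr (y ^ N) = u`.
    have hcard : ((Finset.univ.erase (0 : F)).filter fun δ =>
        Algebra.trace (ZMod p) F ((z₀ / δ) ^ N) = u).card = N * n := by
      rw [← hB]
      refine Finset.card_bij' (fun y _ => z₀ / y) (fun y _ => z₀ / y) ?_ ?_ ?_ ?_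
      · intro y hy
        simp only [Finset.mem_filter, Finset.mem_erase, Finset.mem_univ] at hy ⊢
        exact ⟨trivial, div_ne_zero hz₀ hy.1.1, hy.2⟩
      · intro y hy
        simp only [Finset.mem_filter, Finset.mem_erase, Finset.mem_univ] at hy ⊢
        refine ⟨⟨div_ne_zero hz₀ hy.2.1, trivial⟩, ?_⟩
        rw [div_div_cancel₀ hz₀]
        exact hy.2.2
      · intro y _; exact div_div_cancel₀ hz₀
      · intro y _; exact div_div_cancel₀ hz₀
    have hnot := Finset.card_filter_add_card_filter_not (s := Finset.univ.erase (0 : F))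
      (fun δ => Algebra.trace (ZMod p) F ((z₀ / δ) ^ N) = u)
    rw [Finset.card_erase_of_mem (Finset.mem_univ _), Finset.card_univ, ← hNM, hcard] at hnot
    rw [hcard, Nat.sub_mul, mul_comm n N, mul_comm M N]
    congr 2
    omega

end Weights

/-! ### Length, dimension and weight enumeration -/

section WeightCount

variable {p : ℕ} [Fact p.Prime] {F : Type*} [Field F] [Fintype F] [Algebra (ZMod p) F]

theorem weightCount_code_of_injective {D : Finset (F × F)}
    (h : Function.Injective (codeword p D)) (w : ℕ) :
    weightCount (code p D) w
      = (Finset.univ.filter fun g : F × F => hammingNorm (codeword p D g) = w).card := by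
  rw [weightCount, ← Set.ncard_coe_finset, ← Set.ncard_image_of_injective _ h]
  congr 1
  ext c
  simp only [code, LinearMap.mem_range, Finset.coe_filter, Finset.mem_univ, true_and,
    Set.mem_image, Set.mem_ofPred_eq]
  constructor
  · rintro ⟨⟨g, rfl⟩, hw⟩
    exact ⟨g, hw, rfl⟩
  · rintro ⟨g, hw, rfl⟩
    exact ⟨⟨g, rfl⟩, hw⟩

theorem finrank_code_of_injective {e : ℕ} (hF : Fintype.card F = p ^ e) {D : Finset (F × F)}
    (h : Function.Injective (codeword p D)) : Module.finrank (ZMod p) (code p D) = 2 * e := by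
  rw [code, LinearMap.finrank_range_of_inj h, Module.finrank_prod, finrank_eq_of_card_eq hF]
  ring

variable [DecidableEq F]

/-- The excluded origin satisfies the trace equation exactly when `u = 0`, since `N ≠ 0`; hence the
`- 1` here and none for `u ≠ 0`. -/
theorem card_definingSet_zero {e N : ℕ} (hF : Fintype.card F = p ^ (e + 1)) (hN : N ≠ 0) :
    (definingSet p F N 0).card = p ^ (2 * e + 1) - 1 := by
  rw [← card_filter_trace_add hF (fun y => Algebra.trace (ZMod p) F (y ^ N)) 0,
    ← Finset.card_erase_of_mem (a := (0, 0)) (by simp [hN])]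
  congr 1
  ext z
  simp [definingSet]

theorem card_definingSet_of_ne_zero {e N : ℕ} (hF : Fintype.card F = p ^ (e + 1)) (hN : N ≠ 0)
    {u : ZMod p} (hu : u ≠ 0) : (definingSet p F N u).card = p ^ (2 * e + 1) := by
  rw [← card_filter_trace_add hF (fun y => Algebra.trace (ZMod p) F (y ^ N)) u]
  congr 1
  ext z
  simp only [definingSet, Finset.mem_filter_univ, map_add, and_iff_right_iff_imp]
  rintro h rfl
  simp [hN] at h
  exact hu h.symm

theorem sum_eq_sum_algebraMap_add {β : Type*} [AddCommMonoid β] (H : F → β) (b : β)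
    (hH : ∀ γ ∉ Set.range (algebraMap (ZMod p) F), H γ = b) :
    ∑ γ : F, H γ = ∑ c : ZMod p, H (algebraMap (ZMod p) F c) + (Fintype.card F - p) • b := by
  rw [← Finset.sum_add_sum_compl (Finset.univ.image (algebraMap (ZMod p) F)),
    Finset.sum_image fun _ _ _ _ h => (algebraMap (ZMod p) F).injective h]
  congr 1
  rw [Finset.sum_congr rfl (g := fun _ => b), Finset.sum_const, Finset.card_compl,
    Finset.card_image_of_injective _ (algebraMap (ZMod p) F).injective, Finset.card_univ,
    ZMod.card]
  intro γ hγ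
  exact hH γ (by simpa using hγ)

variable {s M r N : ℕ} {u : ZMod p}

/-- Sums over all words of a function of the weight. -/
theorem sum_hammingNorm_codeword (hF : Fintype.card F = p ^ (2 * (s + 1)))
    (hM : M * r = p ^ (s + 1) + 1) (hN : N = (p ^ (s + 1) - 1) * r) {n : ℕ}
    (hn : (Finset.univ.filter fun ω : F => ω ^ M = 1 ∧ Algebra.trace (ZMod p) F ω = u).card = n)
    {a₀ a₁ a₂ a₃ : ℕ} (h₀ : a₀ + p ^ (2 * s + 1) = p ^ (2 * s + 2))
    (h₁ : a₁ + (if u = 0 then 1 else 0) + n * N = p ^ (2 * s + 2))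
    (h₂ : a₂ + (if u = 0 then 1 else 0) + p ^ (s + 1) = a₀ + n * r)
    (h₃ : a₃ + (if u = 0 then 1 else 0) = a₀ + n * r) (G : ℕ → ℕ) :
    ∑ g : F × F, G (hammingNorm (codeword p (definingSet p F N u) g))
      = G 0 + (p - 1) * G (p ^ (2 * s + 1) * a₁) + (p - 1) * (n * N) * G (p ^ (2 * s + 1) * a₂)
        + (p - 1) * ((M - n) * N) * G (p ^ (2 * s + 1) * a₃)
        + ((p ^ (2 * s + 2) - 1) + (p ^ (2 * s + 2) - p) * p ^ (2 * s + 2))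
          * G (p ^ (2 * s + 1) * a₀) := by
  have hF' : Fintype.card F = p ^ (2 * s + 1 + 1) := hF
  have ha₀ : a₀ = p ^ (2 * s + 2) - p ^ (2 * s + 1) := by omega
  have hout : ∀ γ ∉ Set.range (algebraMap (ZMod p) F),
      ∑ δ : F, G (hammingNorm (codeword p (definingSet p F N u) (γ, δ)))
        = p ^ (2 * s + 2) * G (p ^ (2 * s + 1) * a₀) := by
    intro γ hγ
    rw [Finset.sum_congr rfl (g := fun _ => G (p ^ (2 * s + 1) * a₀)), Finset.sum_const,
      Finset.card_univ, hF', smul_eq_mul]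
    intro δ _
    rw [hammingNorm_codeword, weight_of_notMem_range (e := 2 * s) hF
      (fun y => Algebra.trace (ZMod p) F (y ^ N))
      (fun y => Algebra.trace (ZMod p) F (δ * y)) u hγ, ha₀]
  have hunit : ∀ c ∈ Finset.univ.erase (0 : ZMod p),
      ∑ δ : F, G (hammingNorm (codeword p (definingSet p F N u) (algebraMap (ZMod p) F c, δ)))
        = G (p ^ (2 * s + 1) * a₁) + n * N * G (p ^ (2 * s + 1) * a₂)
          + (M - n) * N * G (p ^ (2 * s + 1) * a₃) := by
    intro c hc
    have hc0 : c ≠ 0 := Finset.ne_of_mem_erase hc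
    have hc0' : algebraMap (ZMod p) F c ≠ 0 := by simpa using hc0
    -- Replacing `δ` by `c * δ` permutes the words and lets the factor `c` be cancelled from the
    -- condition.
    rw [← sum_weight_indicator hF hM hN hn h₁ (by omega) (by omega)
      (fun a => G (p ^ (2 * s + 1) * a)), ← Equiv.sum_comp (Equiv.mulLeft₀ _ hc0')]
    refine Finset.sum_congr rfl fun δ _ => ?_
    rw [hammingNorm_codeword, weight_of_algebraMap hF'
      (fun y => Algebra.trace (ZMod p) F (y ^ N))
      (fun y => Algebra.trace (ZMod p) F (Equiv.mulLeft₀ _ hc0' δ * y)) u c]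
    congr 3
    ext y
    simp only [Finset.mem_filter_univ, Equiv.mulLeft₀_apply, ← Algebra.smul_def, smul_mul_assoc,
      map_smul, smul_eq_mul, ← mul_add, ne_eq, mul_eq_zero, hc0, false_or]
    rw [not_iff_not]
    constructor
    · intro h; linear_combination -h
    · intro h; linear_combination -h
  have hzero : ∀ δ ∈ Finset.univ.erase (0 : F),
      G (hammingNorm (codeword p (definingSet p F N u) (algebraMap (ZMod p) F 0, δ)))
        = G (p ^ (2 * s + 1) * a₀) := by
    intro δ hδ
    rw [hammingNorm_codeword, weight_of_algebraMap hF'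
      (fun y => Algebra.trace (ZMod p) F (y ^ N))
      (fun y => Algebra.trace (ZMod p) F (δ * y)) u 0]
    congr 2
    have hcompl := Finset.card_filter_add_card_filter_not (s := (Finset.univ : Finset F))
      (fun y => Algebra.trace (ZMod p) F (δ * y) = 0)
    have hk := card_filter_trace_mul (Finset.ne_of_mem_erase hδ) (0 : ZMod p)
    rw [hF', pow_succ] at hk
    rw [Nat.eq_of_mul_eq_mul_right (Fact.out : p.Prime).pos hk, Finset.card_univ, hF']
      at hcompl
    simp only [zero_mul, zero_add, ne_eq]
    change p ^ (2 * s + 1) + _ = p ^ (2 * s + 2) at hcompl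
    omega
  have horigin : codeword p (definingSet p F N u) (algebraMap (ZMod p) F 0, 0) = 0 := by
    rw [map_zero]
    exact map_zero _
  rw [Fintype.sum_prod_type, sum_eq_sum_algebraMap_add (p := p) _ _ hout,
    ← Finset.add_sum_erase _ _ (Finset.mem_univ (0 : ZMod p)), Finset.sum_congr rfl hunit,
    ← Finset.add_sum_erase _ _ (Finset.mem_univ (0 : F)), Finset.sum_congr rfl hzero,
    Finset.sum_const, Finset.sum_const, Finset.card_erase_of_mem (Finset.mem_univ _),
    Finset.card_erase_of_mem (Finset.mem_univ _), Finset.card_univ, Finset.card_univ,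
    ZMod.card, hF', smul_eq_mul, smul_eq_mul, smul_eq_mul, horigin, hammingNorm_zero]
  ring

/-- Taking for `G` the indicator of weight zero counts the kernel: none of the four other weights
vanishes, so only the origin contributes. -/
theorem codeword_injective (hF : Fintype.card F = p ^ (2 * (s + 1)))
    (hM : M * r = p ^ (s + 1) + 1) (hN : N = (p ^ (s + 1) - 1) * r) {n : ℕ}
    (hn : (Finset.univ.filter fun ω : F => ω ^ M = 1 ∧ Algebra.trace (ZMod p) F ω = u).card = n)
    {a₀ a₁ a₂ a₃ : ℕ} (h₀ : a₀ + p ^ (2 * s + 1) = p ^ (2 * s + 2))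
    (h₁ : a₁ + (if u = 0 then 1 else 0) + n * N = p ^ (2 * s + 2))
    (h₂ : a₂ + (if u = 0 then 1 else 0) + p ^ (s + 1) = a₀ + n * r)
    (h₃ : a₃ + (if u = 0 then 1 else 0) = a₀ + n * r)
    (h₀' : a₀ ≠ 0) (h₁' : a₁ ≠ 0) (h₂' : a₂ ≠ 0) (h₃' : a₃ ≠ 0) :
    Function.Injective (codeword p (definingSet p F N u)) := by
  have h := sum_hammingNorm_codeword hF hM hN hn h₀ h₁ h₂ h₃ fun w => if w = 0 then 1 else 0
  simp only [mul_eq_zero, h₀', h₁', h₂', h₃', pow_eq_zero_iff', (Fact.out : p.Prime).ne_zero,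
    false_and, or_false, if_false, if_true, mul_zero, add_zero] at h
  rw [← Finset.card_filter, Finset.card_eq_one] at h
  obtain ⟨g₀, hg₀⟩ := h
  simp only [hammingNorm_eq_zero] at hg₀
  have hmem : ∀ g, codeword p (definingSet p F N u) g = 0 ↔ g = g₀ := by
    intro g
    have := Finset.ext_iff.1 hg₀ g
    simpa only [Finset.mem_filter_univ, Finset.mem_singleton] using this
  rw [injective_iff_map_eq_zero]
  intro g hg
  rw [(hmem g).1 hg, ← (hmem 0).1 (map_zero _)]

theorem weightCount_code_eq (hF : Fintype.card F = p ^ (2 * (s + 1)))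
    (hM : M * r = p ^ (s + 1) + 1) (hN : N = (p ^ (s + 1) - 1) * r) {n : ℕ}
    (hn : (Finset.univ.filter fun ω : F => ω ^ M = 1 ∧ Algebra.trace (ZMod p) F ω = u).card = n)
    {a₀ a₁ a₂ a₃ : ℕ} (h₀ : a₀ + p ^ (2 * s + 1) = p ^ (2 * s + 2))
    (h₁ : a₁ + (if u = 0 then 1 else 0) + n * N = p ^ (2 * s + 2))
    (h₂ : a₂ + (if u = 0 then 1 else 0) + p ^ (s + 1) = a₀ + n * r)
    (h₃ : a₃ + (if u = 0 then 1 else 0) = a₀ + n * r)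
    (hinj : Function.Injective (codeword p (definingSet p F N u))) (w : ℕ) :
    weightCount (code p (definingSet p F N u)) w
      = (if 0 = w then 1 else 0) + (if p ^ (2 * s + 1) * a₁ = w then p - 1 else 0)
        + (if p ^ (2 * s + 1) * a₂ = w then (p - 1) * (n * N) else 0)
        + (if p ^ (2 * s + 1) * a₃ = w then (p - 1) * ((M - n) * N) else 0)
        + (if p ^ (2 * s + 1) * a₀ = w
          then (p ^ (2 * s + 2) - 1) + (p ^ (2 * s + 2) - p) * p ^ (2 * s + 2) else 0) := by
  rw [weightCount_code_of_injective hinj, Finset.card_filter,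
    sum_hammingNorm_codeword hF hM hN hn h₀ h₁ h₂ h₃ fun v => if v = w then 1 else 0]
  simp only [mul_ite, mul_one, mul_zero]

end WeightCount

/-! ### Arithmetic of `r`, `p` and `l` behind coinciding weights -/

section Arithmetic

variable {p l j s r : ℕ}

/-- A prime that is a primitive root modulo `2 l ^ (j + 1)` is one modulo `l ^ (j + 1)`, and
half-way through its powers it meets `-1`. -/
theorem exists_half_order (hp : p.Prime) (hp2 : p ≠ 2) (hl : l.Prime) (hl2 : l ≠ 2)
    (hprim : orderOf (p : ZMod (2 * l ^ (j + 1))) = (2 * l ^ (j + 1)).totient) :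
    orderOf (p : ZMod (l ^ (j + 1))) = (l ^ (j + 1)).totient ∧
    ∃ s r, (l ^ (j + 1)).totient = 2 * (s + 1) ∧ l ^ j * (l - 1) = 2 * (s + 1) ∧
      2 * l ^ (j + 1) * r = p ^ (s + 1) + 1 := by
  have hlo : Odd l := hl.odd_of_ne_two hl2
  have hpo : Odd p := hp.odd_of_ne_two hp2
  have hcop2 : Nat.Coprime 2 (l ^ (j + 1)) := (Nat.coprime_two_left.2 hlo.pow)
  have htot : (2 * l ^ (j + 1)).totient = (l ^ (j + 1)).totient := by
    rw [Nat.totient_mul hcop2, Nat.totient_two, one_mul]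
  -- As `p` is odd, `p ^ i - 1` is always even, so the factor `2` of the modulus does not affect the
  -- order.
  have hpow : ∀ i, (p : ZMod (l ^ (j + 1))) ^ i = 1 ↔ (p : ZMod (2 * l ^ (j + 1))) ^ i = 1 := by
    intro i
    have h1 : ∀ m : ℕ, (p : ZMod m) ^ i = 1 ↔ m ∣ p ^ i - 1 := by
      intro m
      rw [← (ZMod.natCast_eq_zero_iff (p ^ i - 1) m),
        Nat.cast_sub (Nat.one_le_pow _ _ hp.pos), sub_eq_zero]
      push_cast
      rfl
    rw [h1, h1]
    refine ⟨fun h => hcop2.mul_dvd_of_dvd_of_dvd ?_ h, fun h => (dvd_mul_left _ _).trans h⟩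
    exact (Nat.Odd.sub_odd hpo.pow odd_one).two_dvd
  have horder : orderOf (p : ZMod (l ^ (j + 1))) = (l ^ (j + 1)).totient := by
    rw [← htot, ← hprim]
    exact orderOf_eq_orderOf_iff.2 hpow
  refine ⟨horder, ?_⟩
  have hphi : (l ^ (j + 1)).totient = l ^ j * (l - 1) := by
    rw [Nat.totient_prime_pow_succ hl]
  have hpos : 0 < (l ^ (j + 1)).totient := Nat.totient_pos.2 (pow_pos hl.pos _)
  obtain ⟨t, ht⟩ : 2 ∣ l - 1 := (Nat.Odd.sub_odd hlo odd_one).two_dvd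
  have ht' : (l ^ (j + 1)).totient = 2 * (l ^ j * t) := by rw [hphi, ht]; ring
  obtain ⟨s, hs⟩ : ∃ s, l ^ j * t = s + 1 := ⟨l ^ j * t - 1, by omega⟩
  rw [hs] at ht'
  have hQ : 1 ≤ p ^ (s + 1) := Nat.one_le_pow _ _ hp.pos
  have hdvd : l ^ (j + 1) ∣ (p ^ (s + 1) + 1) * (p ^ (s + 1) - 1) := by
    have h : (p : ZMod (l ^ (j + 1))) ^ (2 * (s + 1)) = 1 := by
      rw [← ht', ← horder, pow_orderOf_eq_one]
    rw [← Nat.sq_sub_sq, one_pow, ← pow_mul, ← ZMod.natCast_eq_zero_iff,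
      Nat.cast_sub (Nat.one_le_pow _ _ hp.pos), sub_eq_zero, mul_comm (s + 1)]
    push_cast
    exact h
  have hndvd : ¬ l ^ (j + 1) ∣ p ^ (s + 1) - 1 := by
    intro h
    rw [← ZMod.natCast_eq_zero_iff, Nat.cast_sub hQ, sub_eq_zero] at h
    push_cast at h
    have := Nat.le_of_dvd (Nat.succ_pos s) (orderOf_dvd_of_pow_eq_one h)
    rw [horder, ht'] at this
    omega
  -- The odd prime `l` divides at most one of `p ^ (s + 1) ± 1`, so that factor absorbs all of `l ^
  -- (j + 1)`. It is not `p ^ (s + 1) - 1`, as the order would then be at most `s + 1`.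
  have hplus : l ^ (j + 1) ∣ p ^ (s + 1) + 1 := by
    by_cases h : l ∣ p ^ (s + 1) + 1
    · have hnl : ¬ l ∣ p ^ (s + 1) - 1 := by
        intro h'
        have h2 := Nat.dvd_sub h h'
        rw [show p ^ (s + 1) + 1 - (p ^ (s + 1) - 1) = 2 by omega] at h2
        exact hl2 ((Nat.prime_dvd_prime_iff_eq hl Nat.prime_two).1 h2)
      exact (((hl.coprime_iff_not_dvd.2 hnl).pow_left _).dvd_mul_right).1 hdvd
    · exact absurd ((((hl.coprime_iff_not_dvd.2 h).pow_left _).dvd_mul_left).1 hdvd) hndvd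
  obtain ⟨r, hr⟩ := hcop2.mul_dvd_of_dvd_of_dvd (hpo.pow.add_one.two_dvd) hplus
  exact ⟨s, r, ht', by rw [← hphi, ht'], hr.symm⟩

/-- As a divisor of `p ^ (s + 1) + 1`, `r` is prime to `p`; as a divisor of `p ^ i` it must then be
`1`. -/
theorem eq_one_of_mul_eq_prime_pow {M n i : ℕ} (hp : p.Prime)
    (hM : M * r = p ^ (s + 1) + 1) (h : n * r = p ^ i) : r = 1 ∧ n = p ^ i := by
  have hr : r = 1 := by
    have h1 : r ∣ p ^ i := ⟨n, by rw [← h, mul_comm]⟩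
    obtain ⟨m, -, rfl⟩ := (Nat.dvd_prime_pow hp).1 h1
    rcases Nat.eq_zero_or_pos m with rfl | hm
    · rfl
    · exfalso
      have h2 : p ∣ p ^ (s + 1) + 1 := by
        rw [← hM]
        exact Dvd.dvd.mul_left (dvd_pow_self p hm.ne') M
      have h3 := (Nat.dvd_add_right (dvd_pow_self p (Nat.succ_ne_zero s))).1 h2
      exact hp.one_lt.ne' (Nat.dvd_one.1 h3)
  subst hr
  exact ⟨rfl, by simpa using h⟩

theorem even_mul_ne_prime_pow {M n i : ℕ} (hp : p.Prime) (hp2 : p ≠ 2)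
    (hM : M * r = p ^ (s + 1) + 1) (hn : Even n) : n * r ≠ p ^ i := by
  intro h
  have h1 := (eq_one_of_mul_eq_prime_pow hp hM h).2
  exact Nat.not_even_iff_odd.2 ((hp.odd_of_ne_two hp2).pow (n := i)) (h1 ▸ hn)

theorem prime_mul_ne_prime_pow {M i : ℕ} (hp : p.Prime) (hl : l.Prime) (hpl : p ≠ l)
    (hM : M * r = p ^ (s + 1) + 1) : l * r ≠ p ^ i := by
  intro h
  have h1 := (eq_one_of_mul_eq_prime_pow hp hM h).2
  have h2 : l ∣ p ^ i := h1 ▸ dvd_rfl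
  exact hpl ((Nat.prime_dvd_prime_iff_eq hl hp).1 (hl.dvd_of_dvd_pow h2)).symm

theorem coprime_pow_of_mul_eq {M : ℕ} (hp : p.Prime) (hM : M * r = p ^ (s + 1) + 1) (i : ℕ) :
    Nat.Coprime (p ^ i) r := by
  refine Nat.Coprime.pow_left i (hp.coprime_iff_not_dvd.2 fun h => ?_)
  have h2 : p ∣ p ^ (s + 1) + 1 := hM ▸ Dvd.dvd.mul_left h M
  have h3 := (Nat.dvd_add_right (dvd_pow_self p (Nat.succ_ne_zero s))).1 h2
  exact hp.one_lt.ne' (Nat.dvd_one.1 h3)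

theorem two_mul_add_two_lt_three_pow {t : ℕ} (ht : 2 ≤ t) : 2 * (t + 1) < 3 ^ t := by
  induction t, ht using Nat.le_induction with
  | base => norm_num
  | succ t _ ih => rw [pow_succ]; omega

theorem sub_one_le_two_mul (hl : l.Prime) (hs : l ^ j * (l - 1) = 2 * (s + 1)) :
    l - 1 ≤ 2 * (s + 1) := by
  rw [← hs]
  exact Nat.le_mul_of_pos_left _ (pow_pos hl.pos j)

theorem eq_three_of_pow_mul_eq_two (hl : l.Prime) (hl2 : l ≠ 2) (hs : l ^ j * (l - 1) = 2) :
    l = 3 ∧ j = 0 := by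
  have h2 := hl.two_le
  have h3 : l = 3 := by
    have : l - 1 ∣ 2 := ⟨l ^ j, by rw [← hs, mul_comm]⟩
    have := Nat.le_of_dvd (by norm_num) this
    omega
  subst h3
  refine ⟨rfl, ?_⟩
  by_contra hj
  have : 3 ^ j = 1 := by omega
  simp [hj] at this

/-- For `l ≡ 1` modulo `p`, this rules out a coincidence of two weights with `u = 0`. -/
theorem two_mul_sub_one_mul_add_ne (hp : p.Prime) (hp2 : p ≠ 2) (hl : l.Prime) (hl2 : l ≠ 2)
    {M : ℕ} (hM : M * r = p ^ (s + 1) + 1) (hs : l ^ j * (l - 1) = 2 * (s + 1))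
    (hpl : p ∣ l - 1) : 2 * (l - 1) * r + p ^ s ≠ p ^ (s + 1) := by
  intro h
  have hp3 : 3 ≤ p := by have := hp.two_le; omega
  have hl1 : 0 < l - 1 := by have := hl.two_le; omega
  have h1 : p ^ s ∣ 2 * (l - 1) * r :=
    (Nat.dvd_add_left dvd_rfl).1 (h ▸ pow_dvd_pow p (Nat.le_succ s))
  have h2 : p ^ s ∣ 2 * (l - 1) := (coprime_pow_of_mul_eq hp hM s).dvd_of_dvd_mul_right h1
  have hc2 : Nat.Coprime p 2 := Nat.coprime_two_right.2 (hp.odd_of_ne_two hp2)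
  have h3 : p ^ s ∣ l - 1 := (hc2.pow_left s).dvd_of_dvd_mul_left h2
  have h4 : p ^ s ≤ 2 * (s + 1) := (Nat.le_of_dvd hl1 h3).trans (sub_one_le_two_mul hl hs)
  -- This yields `p ≤ s + 1`, hence `2 ≤ s`, where `p ^ s ≤ 2 * (s + 1)` is impossible.
  have h5 : p * 2 ∣ l - 1 := hc2.mul_dvd_of_dvd_of_dvd hpl
    (Nat.Odd.sub_odd (hl.odd_of_ne_two hl2) odd_one).two_dvd
  have h6 := (Nat.le_of_dvd hl1 h5).trans (sub_one_le_two_mul hl hs)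
  have h7 := two_mul_add_two_lt_three_pow (t := s) (by omega)
  have h8 : 3 ^ s ≤ p ^ s := Nat.pow_le_pow_left hp3 s
  omega

/-- Equality would make `p ^ s` divide `l`, so `s = 0` because `p ≠ l`. Then `l ^ j * (l - 1) = 2`,
which forces `j = 0`. -/
theorem two_mul_prime_mul_add_ne (hp : p.Prime) (hp2 : p ≠ 2) (hl : l.Prime) (hl2 : l ≠ 2)
    (hpl : p ≠ l) {M : ℕ} (hM : M * r = p ^ (s + 1) + 1) (hs : l ^ j * (l - 1) = 2 * (s + 1))
    (hj : j ≠ 0) : 2 * l * r + p ^ s ≠ p ^ (s + 1) := by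
  intro h
  have h1 : p ^ s ∣ 2 * l * r :=
    (Nat.dvd_add_left dvd_rfl).1 (h ▸ pow_dvd_pow p (Nat.le_succ s))
  have h2 : p ^ s ∣ 2 * l := (coprime_pow_of_mul_eq hp hM s).dvd_of_dvd_mul_right h1
  have hc2 : Nat.Coprime p 2 := Nat.coprime_two_right.2 (hp.odd_of_ne_two hp2)
  have h3 : p ^ s ∣ l := (hc2.pow_left s).dvd_of_dvd_mul_left h2
  rcases Nat.eq_zero_or_pos s with rfl | hs0
  · exact hj (eq_three_of_pow_mul_eq_two hl hl2 hs).2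
  · exact hpl ((Nat.prime_dvd_prime_iff_eq hp hl).1 ((dvd_pow_self p hs0.ne').trans h3))

/-- Note `p * (p ^ s + 1) - (p ^ (s + 1) + 1) = p - 1`. -/
theorem dvd_sub_one_of_dvd {d : ℕ} (hp : p.Prime) (h1 : d ∣ p ^ s + 1)
    (h2 : d ∣ p ^ (s + 1) + 1) : d ∣ p - 1 := by
  have h := Nat.dvd_sub (Dvd.dvd.mul_left h1 p) h2
  have hp1 := hp.one_le
  rwa [show p * (p ^ s + 1) - (p ^ (s + 1) + 1) = p - 1 by rw [mul_add, ← pow_succ']; omega] at h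

/-- Here `r` divides `p - 1`, so `p ^ s + 1 ≤ p - 1` and `s = 0`. Then `r = 2`, `l = 3`, and `p + 1
= 12`. -/
theorem eq_eleven_of_eq_add_one (hp : p.Prime) (hl : l.Prime) (hl2 : l ≠ 2)
    (hM : 2 * l ^ (j + 1) * r = p ^ (s + 1) + 1) (hs : l ^ j * (l - 1) = 2 * (s + 1))
    (h : r = p ^ s + 1) : l = 3 ∧ j = 0 ∧ p = 11 := by
  have h1 : r ∣ p - 1 := dvd_sub_one_of_dvd hp h.dvd ⟨_, by rw [← hM, mul_comm]⟩
  have hp2 := hp.two_le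
  have h2 := Nat.le_of_dvd (by omega) h1
  rcases Nat.eq_zero_or_pos s with rfl | hs0
  · obtain ⟨rfl, rfl⟩ := eq_three_of_pow_mul_eq_two hl hl2 hs
    refine ⟨rfl, rfl, ?_⟩
    simp only [pow_zero] at h
    subst h
    norm_num at hM
    omega
  · have : p ≤ p ^ s := Nat.le_self_pow hs0.ne' p
    omega

/-- Otherwise `l` divides `p - 1`, hence both `p ^ (s + 1) - 1` and `p ^ (s + 1) + 1`, hence `2`. -/
theorem prime_mul_ne_add_one (hp : p.Prime) (hl : l.Prime) (hl2 : l ≠ 2)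
    (hM : 2 * l ^ (j + 1) * r = p ^ (s + 1) + 1) : l * r ≠ p ^ s + 1 := by
  intro h
  have hdvd : l ∣ p ^ (s + 1) + 1 := by
    rw [← hM, pow_succ]
    exact ⟨2 * l ^ j * r, by ring⟩
  have h1 : l ∣ p - 1 := dvd_sub_one_of_dvd hp ⟨r, h.symm⟩ hdvd
  have h2 : l ∣ p ^ (s + 1) - 1 := h1.trans (by simpa using Nat.sub_dvd_pow_sub_pow p 1 (s + 1))
  have h3 := Nat.dvd_sub hdvd h2
  have hQ : 1 ≤ p ^ (s + 1) := Nat.one_le_pow _ _ hp.pos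
  rw [show p ^ (s + 1) + 1 - (p ^ (s + 1) - 1) = 2 by omega] at h3
  exact hl2 ((Nat.prime_dvd_prime_iff_eq hl Nat.prime_two).1 h3)

/-- Since `r` divides `p - 1`, one gets `p ^ s + 1 ≤ 2 * (s + 1) * (p - 1)`, which leaves `s ≤ 2`
and finitely many `l` and `j`. The pair `p = 3`, `l = 5` must be excluded: with `j = 0`, `s = 1`, `r
= 1` it does solve the equation. -/
theorem eq_five_of_sub_one_mul_eq (hp : p.Prime) (hp2 : p ≠ 2) (hl : l.Prime) (hl2 : l ≠ 2)
    (hpl : p ≠ l) (hM : 2 * l ^ (j + 1) * r = p ^ (s + 1) + 1)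
    (hs : l ^ j * (l - 1) = 2 * (s + 1)) (h35 : ¬ (p = 3 ∧ l = 5))
    (h : (l - 1) * r = p ^ s + 1) : l = 3 ∧ j = 0 ∧ p = 5 := by
  have hp3 : 3 ≤ p := by have := hp.two_le; omega
  have hl3 : 3 ≤ l := by have := hl.two_le; omega
  have h1 : r ∣ p - 1 := dvd_sub_one_of_dvd hp ⟨_, by rw [← h, mul_comm]⟩
    ⟨_, by rw [← hM, mul_comm]⟩
  have h2 : r ≤ p - 1 := Nat.le_of_dvd (by omega) h1
  have hle := sub_one_le_two_mul hl hs
  have h3 : p ^ s + 1 ≤ 2 * (s + 1) * (p - 1) := h ▸ Nat.mul_le_mul hle h2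
  -- Eliminating `r` leaves, for each fixed `l`, `j` and `s`, a polynomial equation in `p` alone.
  have hratio : 2 * l ^ (j + 1) * (p ^ s + 1) = (l - 1) * (p ^ (s + 1) + 1) := by
    rw [← h, ← hM]; ring
  obtain _ | s := s
  · obtain ⟨rfl, rfl⟩ := eq_three_of_pow_mul_eq_two hl hl2 hs
    norm_num at hratio
    exact ⟨rfl, rfl, by omega⟩
  exfalso
  -- From here on `s` is one less than in the statement.
  have h4 : p ^ s < 2 * (s + 2) := by
    by_contra! hcon
    have h5 : 2 * (s + 2) * p ≤ p ^ s * p := Nat.mul_le_mul_right p hcon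
    have h6 : 2 * (s + 1 + 1) * (p - 1) ≤ 2 * (s + 2) * p := Nat.mul_le_mul_left _ (by omega)
    rw [pow_succ] at h3
    omega
  have h8 : 3 ^ s ≤ p ^ s := Nat.pow_le_pow_left hp3 s
  have hs1 : s ≤ 1 := by
    by_contra! hcon
    obtain ⟨t, rfl⟩ : ∃ t, s = t + 2 := ⟨s - 2, by omega⟩
    have : 2 * (t + 2 + 2) < 3 ^ (t + 2) := by
      clear * -
      induction t with
      | zero => norm_num
      | succ t ih => rw [pow_succ, pow_succ, pow_succ]; rw [pow_add] at ih; omega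
    omega
  interval_cases s
  · have hl5 : l ≤ 5 := by omega
    interval_cases l
    · rcases j with _ | j
      · omega
      · rw [pow_succ] at hs; omega
    · norm_num at hl
    · have hj : j = 0 := by
        by_contra hj
        have : 5 ^ j = 1 := by omega
        simp [hj] at this
      subst hj
      norm_num at hratio
      refine h35 ⟨?_, rfl⟩
      nlinarith
  · have hp6 : p < 6 := by simpa using h4
    have hl7 : l ≤ 7 := by omega
    interval_cases l
    · rcases j with _ | _ | j
      · omega
      · interval_cases p <;> omega
      · rw [pow_succ, pow_succ] at hs; omega
    · norm_num at hl
    · omega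
    · norm_num at hl
    · interval_cases p <;> omega

end Arithmetic

/-! ### From weight counts to tables and numbers of weights -/

section Tables

variable {p : ℕ} {ι : Type*} [Fintype ι] {C : Submodule (ZMod p) (ι → ZMod p)}

/-- Needed for `u = 0`, where the stated table lists the row of `a₃` before that of `a₂`. -/
theorem HasWeightTable.swap {x y a b c : ℝ × ℝ} (h : HasWeightTable C [x, y, a, b, c]) :
    HasWeightTable C [x, y, b, a, c] := by
  intro w
  rw [h w]
  simp only [List.map_cons, List.map_nil, List.sum_cons, List.sum_nil]
  ring

variable {W a₀ a₁ a₂ a₃ f₀ f₁ f₂ f₃ : ℕ}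

theorem hasWeightTable_of_weightCount_eq
    (h : ∀ w, weightCount C w = (if 0 = w then 1 else 0) + (if W * a₁ = w then f₁ else 0)
      + (if W * a₂ = w then f₂ else 0) + (if W * a₃ = w then f₃ else 0)
      + (if W * a₀ = w then f₀ else 0)) :
    HasWeightTable C [(0, 1), ((W : ℝ) * a₁, (f₁ : ℝ)), ((W : ℝ) * a₂, (f₂ : ℝ)),
      ((W : ℝ) * a₃, (f₃ : ℝ)), ((W : ℝ) * a₀, (f₀ : ℝ))] := by
  intro w
  have hcast : ∀ a f : ℕ, (if (W : ℝ) * a = w then (f : ℝ) else 0)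
      = ((if W * a = w then f else 0 : ℕ) : ℝ) := by
    intro a f
    rw [Nat.cast_ite, Nat.cast_zero]
    exact if_congr (by exact_mod_cast Iff.rfl) rfl rfl
  have hcast0 : (if (0 : ℝ) = w then (1 : ℝ) else 0) = ((if 0 = w then 1 else 0 : ℕ) : ℝ) := by
    rw [Nat.cast_ite, Nat.cast_zero, Nat.cast_one]
    exact if_congr (by exact_mod_cast Iff.rfl) rfl rfl
  simp only [List.map_cons, List.map_nil, List.sum_cons, List.sum_nil, hcast, hcast0, h]
  push_cast
  ring

/-- Scaling by `W` is injective, so the number of weights is the number of distinct reduced weights.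
-/
theorem isWeightCode_iff_of_support (hW : W ≠ 0) {A : Finset ℕ}
    (hA : ∀ w, w ≠ 0 → (weightCount C w ≠ 0 ↔ ∃ a ∈ A, W * a = w)) (h0 : 0 ∉ A) (t : ℕ) :
    IsWeightCode t C ↔ A.card = t := by
  have hset : {w : ℕ | 1 ≤ w ∧ weightCount C w ≠ 0} = (A.image fun a => W * a : Finset ℕ) := by
    ext w
    simp only [Set.mem_ofPred_eq, Finset.coe_image, Set.mem_image, Finset.mem_coe]
    constructor
    · rintro ⟨hw, hc⟩
      exact (hA w (by omega)).1 hc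
    · rintro ⟨a, ha, rfl⟩
      have hne : W * a ≠ 0 := mul_ne_zero hW (by rintro rfl; exact h0 ha)
      exact ⟨Nat.pos_of_ne_zero hne, (hA _ hne).2 ⟨a, ha, rfl⟩⟩
  rw [IsWeightCode, hset, Set.ncard_coe_finset, Finset.card_image_of_injective]
  intro a b hab
  exact Nat.eq_of_mul_eq_mul_left (Nat.pos_of_ne_zero hW) hab

theorem isWeightCode_iff_card (hW : W ≠ 0)
    (h : ∀ w, weightCount C w = (if 0 = w then 1 else 0) + (if W * a₁ = w then f₁ else 0)
      + (if W * a₂ = w then f₂ else 0) + (if W * a₃ = w then f₃ else 0)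
      + (if W * a₀ = w then f₀ else 0))
    (h₀ : a₀ ≠ 0) (h₁ : a₁ ≠ 0) (h₂ : a₂ ≠ 0) (h₃ : a₃ ≠ 0)
    (hf₀ : f₀ ≠ 0) (hf₁ : f₁ ≠ 0) (hf₂ : f₂ ≠ 0) (hf₃ : f₃ ≠ 0) (t : ℕ) :
    IsWeightCode t C ↔ ({a₁, a₂, a₃, a₀} : Finset ℕ).card = t := by
  refine isWeightCode_iff_of_support hW (fun w hw => ?_) ?_ t
  · rw [h, if_neg hw.symm]
    simp only [Finset.mem_insert, Finset.mem_singleton, exists_eq_or_imp, exists_eq_left, ne_eq,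
      Nat.add_eq_zero_iff, ite_eq_right_iff, hf₀, hf₁, hf₂, hf₃, imp_false]
    tauto
  · simp [h₀.symm, h₁.symm, h₂.symm, h₃.symm]

/-- The variant for `n = 0`, where the row of `a₂` is void. -/
theorem isWeightCode_iff_card_of_eq_zero (hW : W ≠ 0)
    (h : ∀ w, weightCount C w = (if 0 = w then 1 else 0) + (if W * a₁ = w then f₁ else 0)
      + (if W * a₂ = w then f₂ else 0) + (if W * a₃ = w then f₃ else 0)
      + (if W * a₀ = w then f₀ else 0))
    (h₀ : a₀ ≠ 0) (h₁ : a₁ ≠ 0) (h₃ : a₃ ≠ 0)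
    (hf₀ : f₀ ≠ 0) (hf₁ : f₁ ≠ 0) (hf₂ : f₂ = 0) (hf₃ : f₃ ≠ 0) (t : ℕ) :
    IsWeightCode t C ↔ ({a₁, a₃, a₀} : Finset ℕ).card = t := by
  refine isWeightCode_iff_of_support hW (fun w hw => ?_) ?_ t
  · rw [h, if_neg hw.symm]
    simp only [Finset.mem_insert, Finset.mem_singleton, exists_eq_or_imp, exists_eq_left, ne_eq,
      Nat.add_eq_zero_iff, ite_eq_right_iff, hf₀, hf₁, hf₂, hf₃, imp_false]
    tauto
  · simp [h₀.symm, h₁.symm, h₃.symm]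

end Tables

/-! ### Reduced weights and their coincidences -/

section Distribution

/-- The weights of the code, divided by `p ^ (2 * s + 1)`. Here `n` is the number of `M`-th roots
of unity of trace `u`, and `ε` is `1` or `0` according to whether `u` vanishes. -/
structure IsReducedWeights (p s r N n ε a₀ a₁ a₂ a₃ : ℕ) : Prop where
  eq₀ : a₀ + p ^ (2 * s + 1) = p ^ (2 * s + 2)
  eq₁ : a₁ + ε + n * N = p ^ (2 * s + 2)
  eq₂ : a₂ + ε + p ^ (s + 1) = a₀ + n * r
  eq₃ : a₃ + ε = a₀ + n * r
  ne₀ : a₀ ≠ 0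
  ne₁ : a₁ ≠ 0
  ne₂ : a₂ ≠ 0
  ne₃ : a₃ ≠ 0

variable {p s r N n ε M : ℕ}

theorem mul_eq_pow_sub_one (hM : M * r = p ^ (s + 1) + 1) (hN : N = (p ^ (s + 1) - 1) * r) :
    N * M = p ^ (2 * s + 2) - 1 := by
  rw [hN, mul_assoc, mul_comm r, hM, mul_comm, ← Nat.sq_sub_sq (p ^ (s + 1)) 1, ← pow_mul,
    one_pow]
  congr 2
  ring

/-- The bound `n + ε ≤ M` is what makes `a₁` positive: `n * N + ε * N ≤ N * M = q - 1`. The other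
weights are positive because `q` is at least `3 * p ^ (2 * s + 1)`. -/
theorem exists_isReducedWeights (hp : 3 ≤ p) (hM : M * r = p ^ (s + 1) + 1)
    (hN : N = (p ^ (s + 1) - 1) * r) (hε : ε ≤ 1) (hn : n + ε ≤ M) :
    ∃ a₀ a₁ a₂ a₃, IsReducedWeights p s r N n ε a₀ a₁ a₂ a₃ := by
  have hNM := mul_eq_pow_sub_one hM hN
  have hQ : 3 ≤ p ^ (s + 1) := hp.trans (Nat.le_self_pow (Nat.succ_ne_zero s) p)
  have hQP : p ^ (s + 1) ≤ p ^ (2 * s + 1) := Nat.pow_le_pow_right (by omega) (by omega)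
  have hPq : 3 * p ^ (2 * s + 1) ≤ p ^ (2 * s + 2) := by
    rw [pow_succ p (2 * s + 1), mul_comm]
    exact Nat.mul_le_mul_left _ hp
  have hr : 0 < r := Nat.pos_of_ne_zero (by rintro rfl; simp at hM)
  have hN0 : 0 < N := by rw [hN]; exact Nat.mul_pos (by omega) hr
  have h1 : (n + ε) * N ≤ N * M := by rw [mul_comm N]; exact Nat.mul_le_mul_right N hn
  have h2 : ε * N ≥ ε := Nat.le_mul_of_pos_right _ hN0
  rw [add_mul] at h1
  exact ⟨p ^ (2 * s + 2) - p ^ (2 * s + 1), p ^ (2 * s + 2) - ε - n * N,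
    p ^ (2 * s + 2) - p ^ (2 * s + 1) + n * r - ε - p ^ (s + 1),
    p ^ (2 * s + 2) - p ^ (2 * s + 1) + n * r - ε,
    by omega, by omega, by omega, by omega, by omega, by omega, by omega, by omega⟩

variable {a₀ a₁ a₂ a₃ : ℕ}

theorem IsReducedWeights.a₂_ne_a₃ (h : IsReducedWeights p s r N n ε a₀ a₁ a₂ a₃) (hp : 0 < p) :
    a₂ ≠ a₃ := by
  have := h.eq₂
  have := h.eq₃
  have := pow_pos hp (s + 1)
  omega

/-- Coincidences among the weights for `u ≠ 0`. -/
theorem IsReducedWeights.eq_cases_of_ne (h : IsReducedWeights p s r N n 0 a₀ a₁ a₂ a₃)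
    (hp : 3 ≤ p) (hN : N = (p ^ (s + 1) - 1) * r) :
    a₁ ≠ a₀ ∧ (a₂ = a₀ → n * r = p ^ (s + 1)) ∧ (a₃ = a₀ → n * r = 0)
      ∧ (a₁ = a₂ → n * r = p ^ s + 1) ∧ (a₁ = a₃ → n * r = p ^ s) := by
  obtain ⟨e₀, e₁, e₂, e₃, -, -, -, -⟩ := h
  have hQ : 3 ≤ p ^ (s + 1) := hp.trans (Nat.le_self_pow (Nat.succ_ne_zero s) p)
  have hN' : n * N + n * r = p ^ (s + 1) * (n * r) := by
    obtain ⟨t, ht⟩ : ∃ t, p ^ (s + 1) = t + 1 := ⟨p ^ (s + 1) - 1, by omega⟩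
    rw [hN, ht, Nat.add_sub_cancel]
    ring
  have hP : p ^ (2 * s + 1) = p ^ (s + 1) * p ^ s := by ring
  refine ⟨fun h10 => ?_, fun h20 => by omega, fun h30 => by omega, fun h12 => ?_, fun h13 => ?_⟩
  -- `a₁ = a₀` means `n * N = p ^ (2 * s + 1)`. But `p ^ (s + 1) - 1` divides `N`, is prime to `p`
  -- and exceeds `1`.
  · have h1 : p ^ (s + 1) - 1 ∣ p ^ (2 * s + 1) := by
      refine ⟨n * r, ?_⟩
      rw [show p ^ (2 * s + 1) = n * N by omega, hN]
      ring
    have h2 : Nat.Coprime (p ^ (s + 1) - 1) p := by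
      have h3 : Nat.Coprime (p ^ (s + 1) - 1) (p ^ (s + 1)) := by
        obtain ⟨t, ht⟩ : ∃ t, p ^ (s + 1) = t + 1 := ⟨p ^ (s + 1) - 1, by omega⟩
        rw [ht, Nat.add_sub_cancel]
        exact Nat.coprime_self_add_right.2 (Nat.coprime_one_right t)
      exact (Nat.coprime_pow_right_iff (Nat.succ_pos s) _ _).1 h3
    have h4 := Nat.Coprime.eq_one_of_dvd (h2.pow_right (2 * s + 1)) h1
    omega
  · refine Nat.eq_of_mul_eq_mul_left (show 0 < p ^ (s + 1) by omega) ?_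
    rw [mul_add, ← hP]
    omega
  · refine Nat.eq_of_mul_eq_mul_left (show 0 < p ^ (s + 1) by omega) ?_
    rw [← hP]
    omega

/-- Coincidences among the weights for `u = 0`, in terms of the number `m` of roots of unity of
nonzero trace. -/
theorem IsReducedWeights.eq_cases_of_eq (h : IsReducedWeights p s r N n 1 a₀ a₁ a₂ a₃)
    (hp : 3 ≤ p) (hM : M * r = p ^ (s + 1) + 1) (hN : N = (p ^ (s + 1) - 1) * r) {m : ℕ}
    (hm : n + m = M) (hm0 : m ≠ 0) :
    (a₁ = a₀ → m * r = p ^ (s + 1)) ∧ a₂ ≠ a₀ ∧ (a₃ = a₀ → m * r = p ^ (s + 1))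
      ∧ (a₁ = a₂ → m * r + p ^ s = p ^ (s + 1)) ∧ (a₁ = a₃ → n * r = p ^ s) := by
  obtain ⟨e₀, e₁, e₂, e₃, -, -, -, -⟩ := h
  have hQ : 3 ≤ p ^ (s + 1) := hp.trans (Nat.le_self_pow (Nat.succ_ne_zero s) p)
  have hr : r ≠ 0 := by rintro rfl; simp at hM
  have hd : n * r + m * r = p ^ (s + 1) + 1 := by rw [← add_mul, hm, hM]
  have hd0 : 0 < m * r := Nat.pos_of_ne_zero (mul_ne_zero hm0 hr)
  have hN' : n * N + n * r = p ^ (s + 1) * (n * r) := by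
    obtain ⟨t, ht⟩ : ∃ t, p ^ (s + 1) = t + 1 := ⟨p ^ (s + 1) - 1, by omega⟩
    rw [hN, ht, Nat.add_sub_cancel]
    ring
  have hP : p ^ (2 * s + 1) = p ^ (s + 1) * p ^ s := by ring
  have hq : p ^ (2 * s + 2) = p ^ (s + 1) * p ^ (s + 1) := by ring
  have hQd : p ^ (s + 1) * (n * r) + p ^ (s + 1) * (m * r)
      = p ^ (s + 1) * p ^ (s + 1) + p ^ (s + 1) := by rw [← mul_add, hd]; ring
  have hTpos : 1 ≤ p ^ s := Nat.one_le_pow _ _ (by omega)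
  have hTQ : p ^ s ≤ p ^ (s + 1) := Nat.pow_le_pow_right (by omega) (by omega)
  refine ⟨fun h10 => ?_, fun h20 => by omega, fun h30 => by omega, fun h12 => ?_, fun h13 => ?_⟩
  -- Modulo `p ^ (s + 1)` this gives `p ^ (s + 1) ∣ m * r`, and `0 < m * r ≤ p ^ (s + 1) + 1` leaves
  -- only equality.
  · have h1 : p ^ (s + 1) * (m * r) + p ^ (s + 1) * p ^ s
        = p ^ (s + 1) * p ^ (s + 1) + m * r := by omega
    have h2 : p ^ (s + 1) ∣ m * r :=
      (Nat.dvd_add_right (dvd_mul_right _ _)).1 (h1 ▸ dvd_add (dvd_mul_right _ _)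
        (dvd_mul_right _ _))
    obtain ⟨t, ht⟩ := h2
    have ht0 : t ≠ 0 := by rintro rfl; omega
    have h3 : m * r ≤ p ^ (s + 1) + 1 := by omega
    have ht1 : t = 1 := by
      by_contra hne
      have : p ^ (s + 1) * 2 ≤ p ^ (s + 1) * t := Nat.mul_le_mul_left _ (by omega)
      omega
    rw [ht, ht1, mul_one]
  · refine Nat.eq_of_mul_eq_mul_left (show 0 < p ^ (s + 1) by omega) ?_
    rw [mul_add, ← hP]
    omega
  · refine Nat.eq_of_mul_eq_mul_left (show 0 < p ^ (s + 1) by omega) ?_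
    rw [← hP]
    omega

theorem card_four_eq_four {a b c d : ℕ} (hab : a ≠ b) (hac : a ≠ c) (had : a ≠ d) (hbc : b ≠ c)
    (hbd : b ≠ d) (hcd : c ≠ d) : ({a, b, c, d} : Finset ℕ).card = 4 := by
  rw [Finset.card_insert_of_notMem (by simp [hab, hac, had]),
    Finset.card_insert_of_notMem (by simp [hbc, hbd]), Finset.card_pair hcd]

end Distribution

/-! ### The number of roots of unity of given trace -/

section RootCounts

variable {p : ℕ} [Fact p.Prime]

theorem eq_zero_of_eq_neg_self (hp2 : p ≠ 2) {u : ZMod p} (h : u = -u) : u = 0 := by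
  have h2 : (2 : ZMod p) ≠ 0 := Ring.two_ne_zero (by rwa [ZMod.ringChar_zmod_n])
  exact (mul_eq_zero.1 (show 2 * u = 0 by linear_combination h)).resolve_left h2

/-- The number of `2 l ^ (j + 1)`-th roots of unity of trace `u`, where `φ` is the trace of `1`
and `g = l ^ j` modulo `p`. -/
def rootCount (l j : ℕ) (φ g u : ZMod p) : ℕ :=
  ((if u = φ then 1 else 0) + (if u = -g then l - 1 else 0)
    + (if u = 0 then l ^ (j + 1) - l else 0))
  + ((if -u = φ then 1 else 0) + (if -u = -g then l - 1 else 0)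
    + (if -u = 0 then l ^ (j + 1) - l else 0))

variable {l j : ℕ} {φ g u : ZMod p}

theorem rootCount_zero_of_eq (hl : 0 < l) (hg : g ≠ 0) (hφ : φ = 0) :
    rootCount l j φ g 0 + 2 * (l - 1) = 2 * l ^ (j + 1) := by
  have : l ≤ l ^ (j + 1) := Nat.le_self_pow (Nat.succ_ne_zero j) l
  simp only [rootCount, hφ, neg_zero, zero_eq_neg, hg, if_true, if_false]
  omega

theorem rootCount_zero_of_ne (hg : g ≠ 0) (hφ : φ ≠ 0) :
    rootCount l j φ g 0 + 2 * l = 2 * l ^ (j + 1) := by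
  have : l ≤ l ^ (j + 1) := Nat.le_self_pow (Nat.succ_ne_zero j) l
  simp only [rootCount, hφ.symm, neg_zero, zero_eq_neg, hg, if_true, if_false]
  omega

theorem rootCount_of_ne_of_ne (hu : u ≠ 0) (hφ : u ^ 2 ≠ φ ^ 2) (hg : u ^ 2 ≠ g ^ 2) :
    rootCount l j φ g u = 0 := by
  rw [Ne, sq_eq_sq_iff_eq_or_eq_neg, not_or] at hφ hg
  have h1 : -u ≠ φ := fun h => hφ.2 (by rw [← h, neg_neg])
  simp only [rootCount, hu, hφ.1, hg.1, hg.2, h1, neg_inj, neg_eq_zero, if_false, add_zero]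

theorem rootCount_of_eq_of_ne (hp2 : p ≠ 2) (hu : u ≠ 0) (hφ : u ^ 2 = φ ^ 2)
    (hg : u ^ 2 ≠ g ^ 2) : rootCount l j φ g u = 1 := by
  rw [Ne, sq_eq_sq_iff_eq_or_eq_neg, not_or] at hg
  have huu : u ≠ -u := fun h => hu (eq_zero_of_eq_neg_self hp2 h)
  rcases sq_eq_sq_iff_eq_or_eq_neg.1 hφ with h | h
  · simp only [rootCount, hu, ← h, hg.1, hg.2, huu.symm, neg_inj, neg_eq_zero, if_false, if_true,
      add_zero]
  · have h' : φ = -u := by rw [h, neg_neg]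
    simp only [rootCount, hu, h', hg.1, hg.2, huu, neg_inj, neg_eq_zero, if_false, if_true,
      add_zero, zero_add]

theorem rootCount_of_ne_of_eq (hp2 : p ≠ 2) (hu : u ≠ 0) (hφ : u ^ 2 ≠ φ ^ 2)
    (hg : u ^ 2 = g ^ 2) : rootCount l j φ g u = l - 1 := by
  rw [Ne, sq_eq_sq_iff_eq_or_eq_neg, not_or] at hφ
  have h1 : -u ≠ φ := fun h => hφ.2 (by rw [← h, neg_neg])
  have huu : u ≠ -u := fun h => hu (eq_zero_of_eq_neg_self hp2 h)
  rcases sq_eq_sq_iff_eq_or_eq_neg.1 hg with h | h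
  · simp only [rootCount, hu, ← h, hφ.1, h1, huu, neg_eq_zero, if_false, if_true,
      add_zero, zero_add]
  · have h' : g = -u := by rw [h, neg_neg]
    simp only [rootCount, hu, h', hφ.1, h1, huu.symm, neg_neg, neg_eq_zero, if_false, if_true,
      add_zero, zero_add]

/-- The root `±1` and the `l - 1` others come from opposite halves of the `2 l ^ (j + 1)`-th roots.
In the application `φ = g * (l - 1)`, so `φ = -g` would give `p ∣ l`; thus `φ ^ 2 = g ^ 2` occurs
only as `φ = g`. -/
theorem rootCount_of_eq_of_eq (hp2 : p ≠ 2) (hl : 0 < l) (hu : u ≠ 0)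
    (h : (u = φ ∧ φ = g) ∨ (u = -φ ∧ -φ = -g)) : rootCount l j φ g u = l := by
  have huu : u ≠ -u := fun h => hu (eq_zero_of_eq_neg_self hp2 h)
  rcases h with ⟨h1, h2⟩ | ⟨h1, h2⟩
  · simp only [rootCount, hu, ← h2, ← h1, huu, huu.symm, neg_eq_zero, if_false, if_true, add_zero, zero_add]
    omega
  · have h3 : φ = -u := by rw [h1, neg_neg]
    have h4 : g = -u := by rw [← h3, neg_inj.1 h2]
    simp only [rootCount, hu, h3, h4, huu, huu.symm, neg_neg, neg_eq_zero, if_false,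
      if_true, add_zero, zero_add]
    omega

/-- For `u = 0` some roots have nonzero trace, which pays for the extra `1`; for `u ≠ 0` there are
at most `2 * l` roots. -/
theorem rootCount_add_le (hl : 2 ≤ l) (hg : g ≠ 0) :
    rootCount l j φ g u + (if u = 0 then 1 else 0) ≤ 2 * l ^ (j + 1) := by
  have : l ≤ l ^ (j + 1) := Nat.le_self_pow (Nat.succ_ne_zero j) l
  by_cases hu : u = 0
  · subst hu
    rw [if_pos rfl]
    by_cases hφ : φ = 0
    · have := rootCount_zero_of_eq (j := j) (show 0 < l by omega) hg hφ
      omega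
    · have := rootCount_zero_of_ne (l := l) (j := j) hg hφ
      omega
  · have h1 : (if u = φ then 1 else 0) ≤ 1 := by split_ifs <;> omega
    have h2 : (if -u = φ then 1 else 0) ≤ 1 := by split_ifs <;> omega
    have h3 : (if u = -g then l - 1 else 0) ≤ l - 1 := by split_ifs <;> omega
    have h4 : (if -u = -g then l - 1 else 0) ≤ l - 1 := by split_ifs <;> omega
    simp only [rootCount, hu, neg_eq_zero, if_false]
    omega

end RootCounts

/-! ### The distribution in terms of `n` -/

section Main

theorem frequency_ne_zero {p s : ℕ} (hp : 3 ≤ p) :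
    (p ^ (2 * s + 2) - 1) + (p ^ (2 * s + 2) - p) * p ^ (2 * s + 2) ≠ 0 := by
  have : p ≤ p ^ (2 * s + 2) := Nat.le_self_pow (by omega) p
  omega

variable {p : ℕ} [Fact p.Prime] {F : Type*} [Field F] [Fintype F] [DecidableEq F]
  [Algebra (ZMod p) F] {s r M N n : ℕ} {u : ZMod p}

/-- The frequencies of the code in terms of the number `n` of `M`-th roots of unity of
trace `u`. -/
theorem exists_weight_distribution (hp : 3 ≤ p) (hF : Fintype.card F = p ^ (2 * (s + 1)))
    (hM : M * r = p ^ (s + 1) + 1) (hN : N = (p ^ (s + 1) - 1) * r)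
    (hn : (Finset.univ.filter fun ω : F => ω ^ M = 1 ∧ Algebra.trace (ZMod p) F ω = u).card = n)
    (hnM : n + (if u = 0 then 1 else 0) ≤ M) :
    ∃ a₀ a₁ a₂ a₃, IsReducedWeights p s r N n (if u = 0 then 1 else 0) a₀ a₁ a₂ a₃ ∧
      Function.Injective (codeword p (definingSet p F N u)) ∧
      ∀ w, weightCount (code p (definingSet p F N u)) w
        = (if 0 = w then 1 else 0) + (if p ^ (2 * s + 1) * a₁ = w then p - 1 else 0)
        + (if p ^ (2 * s + 1) * a₂ = w then (p - 1) * (n * N) else 0)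
        + (if p ^ (2 * s + 1) * a₃ = w then (p - 1) * ((M - n) * N) else 0)
        + (if p ^ (2 * s + 1) * a₀ = w
          then (p ^ (2 * s + 2) - 1) + (p ^ (2 * s + 2) - p) * p ^ (2 * s + 2) else 0) := by
  obtain ⟨a₀, a₁, a₂, a₃, h⟩ := exists_isReducedWeights (ε := if u = 0 then 1 else 0) hp hM hN
    (by split_ifs <;> omega) hnM
  have hinj := codeword_injective hF hM hN hn h.eq₀ h.eq₁ h.eq₂ h.eq₃ h.ne₀ h.ne₁ h.ne₂ h.ne₃
  exact ⟨a₀, a₁, a₂, a₃, h, hinj,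
    weightCount_code_eq hF hM hN hn h.eq₀ h.eq₁ h.eq₂ h.eq₃ hinj⟩

/-- The passage to real numbers is made once, so that each case of the theorem only has to verify
one identity per table entry. -/
theorem hasWeightTable_of_distribution {ι : Type*} [Fintype ι]
    {C : Submodule (ZMod p) (ι → ZMod p)} {ε a₀ a₁ a₂ a₃ : ℕ}
    (h : IsReducedWeights p s r N n ε a₀ a₁ a₂ a₃) (hnM : n ≤ M)
    (hC : ∀ w, weightCount C w
        = (if 0 = w then 1 else 0) + (if p ^ (2 * s + 1) * a₁ = w then p - 1 else 0)
        + (if p ^ (2 * s + 1) * a₂ = w then (p - 1) * (n * N) else 0)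
        + (if p ^ (2 * s + 1) * a₃ = w then (p - 1) * ((M - n) * N) else 0)
        + (if p ^ (2 * s + 1) * a₀ = w
          then (p ^ (2 * s + 2) - 1) + (p ^ (2 * s + 2) - p) * p ^ (2 * s + 2) else 0))
    {w₀ w₁ w₂ w₃ f₀ f₁ f₂ f₃ : ℝ}
    (hw₀ : w₀ = (p : ℝ) ^ (2 * s + 1) * ((p : ℝ) ^ (2 * s + 2) - (p : ℝ) ^ (2 * s + 1)))
    (hw₁ : w₁ = (p : ℝ) ^ (2 * s + 1) * ((p : ℝ) ^ (2 * s + 2) - ε - n * N))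
    (hw₂ : w₂ = (p : ℝ) ^ (2 * s + 1) * ((p : ℝ) ^ (2 * s + 2) - (p : ℝ) ^ (2 * s + 1)
      + n * r - ε - (p : ℝ) ^ (s + 1)))
    (hw₃ : w₃ = (p : ℝ) ^ (2 * s + 1) * ((p : ℝ) ^ (2 * s + 2) - (p : ℝ) ^ (2 * s + 1)
      + n * r - ε))
    (hf₀ : f₀ = ((p : ℝ) ^ (2 * s + 2) - 1)
      + ((p : ℝ) ^ (2 * s + 2) - p) * (p : ℝ) ^ (2 * s + 2))
    (hf₁ : f₁ = (p : ℝ) - 1) (hf₂ : f₂ = ((p : ℝ) - 1) * (n * N))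
    (hf₃ : f₃ = ((p : ℝ) - 1) * ((M - n) * N)) :
    HasWeightTable C [(0, 1), (w₁, f₁), (w₂, f₂), (w₃, f₃), (w₀, f₀)] := by
  have hp1 : 1 ≤ p := (Fact.out : p.Prime).one_le
  have hpq : p ≤ p ^ (2 * s + 2) := Nat.le_self_pow (by omega) p
  have e₀ : (a₀ : ℝ) + (p : ℝ) ^ (2 * s + 1) = (p : ℝ) ^ (2 * s + 2) := by exact_mod_cast h.eq₀
  have e₁ : (a₁ : ℝ) + ε + n * N = (p : ℝ) ^ (2 * s + 2) := by exact_mod_cast h.eq₁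
  have e₂ : (a₂ : ℝ) + ε + (p : ℝ) ^ (s + 1) = a₀ + n * r := by exact_mod_cast h.eq₂
  have e₃ : (a₃ : ℝ) + ε = a₀ + n * r := by exact_mod_cast h.eq₃
  have ht := hasWeightTable_of_weightCount_eq hC
  rw [Nat.cast_add, Nat.cast_sub (hp1.trans hpq), Nat.cast_mul (p ^ (2 * s + 2) - p),
    Nat.cast_sub hpq, Nat.cast_mul (p - 1), Nat.cast_mul (p - 1), Nat.cast_sub hp1,
    Nat.cast_mul (M - n), Nat.cast_sub hnM, Nat.cast_mul n N] at ht
  push_cast at ht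
  rw [show (a₁ : ℝ) = (p : ℝ) ^ (2 * s + 2) - ε - n * N by linear_combination e₁,
    show (a₂ : ℝ) = (p : ℝ) ^ (2 * s + 2) - (p : ℝ) ^ (2 * s + 1) + n * r - ε
      - (p : ℝ) ^ (s + 1) by linear_combination e₂ + e₀,
    show (a₃ : ℝ) = (p : ℝ) ^ (2 * s + 2) - (p : ℝ) ^ (2 * s + 1) + n * r - ε by
      linear_combination e₃ + e₀,
    show (a₀ : ℝ) = (p : ℝ) ^ (2 * s + 2) - (p : ℝ) ^ (2 * s + 1) by linear_combination e₀] at ht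
  rw [hw₀, hw₁, hw₂, hw₃, hf₀, hf₁, hf₂, hf₃]
  exact ht

end Main

end TraceCode

/-! ### The theorem, case by case -/

set_option maxHeartbeats 1000000 in
theorem theorem1 (p ℓ k e q : ℕ) [Fact p.Prime] (hℓ : ℓ.Prime) (hp2 : p ≠ 2) (hℓ2 : ℓ ≠ 2)
    (hpℓ : p ≠ ℓ) (hk : 1 ≤ k) (he : e = Nat.totient (ℓ ^ k)) (hq : q = p ^ e)
    (hprim : orderOf (p : ZMod (2 * ℓ ^ k)) = Nat.totient (2 * ℓ ^ k))
    (F : Type*) [Field F] [Fintype F] [DecidableEq F] [Algebra (ZMod p) F]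
    (hF : Fintype.card F = q)
    (N : ℕ) (hN : N = (q - 1) / (2 * ℓ ^ k)) (u : ZMod p)
    (D : Finset (F × F)) (hD : D = TraceCode.definingSet p F N u) :
    -- length
    (u = 0 → D.card = p ^ (2 * e - 1) - 1) ∧
    (u ≠ 0 → D.card = p ^ (2 * e - 1)) ∧
    -- dimension
    Module.finrank (ZMod p) (TraceCode.code p D) = 2 * e ∧
    -- case 1
    (u = 0 → (ℓ : ZMod p) = 1 →
      TraceCode.HasWeightTable (TraceCode.code p D)
        [(0, 1),
         ((p : ℝ) ^ (e - 1) * ((ℓ : ℝ) - 1) * (((q : ℝ) - 1) / (ℓ : ℝ) ^ k),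
           (p : ℝ) - 1),
         ((p : ℝ) ^ (2 * e - 2) * ((p : ℝ) - 1)
            + (p : ℝ) ^ (e - 1) * (√(q : ℝ) - ((ℓ : ℝ) - 1) * ((√(q : ℝ) + 1) / (ℓ : ℝ) ^ k)),
           ((p : ℝ) - 1) * ((ℓ : ℝ) - 1) * (((q : ℝ) - 1) / (ℓ : ℝ) ^ k)),
         ((p : ℝ) ^ (2 * e - 2) * ((p : ℝ) - 1)
            - (p : ℝ) ^ (e - 1) * ((ℓ : ℝ) - 1) * ((√(q : ℝ) + 1) / (ℓ : ℝ) ^ k),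
           ((p : ℝ) - 1) * ((ℓ : ℝ) ^ k - (ℓ : ℝ) + 1) * (((q : ℝ) - 1) / (ℓ : ℝ) ^ k)),
         ((p : ℝ) ^ (2 * e - 2) * ((p : ℝ) - 1),
           ((q : ℝ) - 1) + ((q : ℝ) - (p : ℝ)) * (q : ℝ))] ∧
      TraceCode.IsWeightCode 4 (TraceCode.code p D)) ∧
    -- case 2
    (u = 0 → (ℓ : ZMod p) ≠ 1 →
      TraceCode.HasWeightTable (TraceCode.code p D)
        [(0, 1),
         ((p : ℝ) ^ (e - 1) * (((q : ℝ) - 1) / (ℓ : ℝ) ^ (k - 1)),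
           (p : ℝ) - 1),
         ((p : ℝ) ^ (2 * e - 2) * ((p : ℝ) - 1)
            + (p : ℝ) ^ (e - 1) * (√(q : ℝ) - (√(q : ℝ) + 1) / (ℓ : ℝ) ^ (k - 1)),
           ((p : ℝ) - 1) * (((q : ℝ) - 1) / (ℓ : ℝ) ^ (k - 1))),
         ((p : ℝ) ^ (2 * e - 2) * ((p : ℝ) - 1)
            - (p : ℝ) ^ (e - 1) * ((√(q : ℝ) + 1) / (ℓ : ℝ) ^ (k - 1)),
           ((p : ℝ) - 1) * ((ℓ : ℝ) ^ (k - 1) - 1) * (((q : ℝ) - 1) / (ℓ : ℝ) ^ (k - 1))),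
         ((p : ℝ) ^ (2 * e - 2) * ((p : ℝ) - 1),
           ((q : ℝ) - 1) + ((q : ℝ) - (p : ℝ)) * (q : ℝ))] ∧
      (k ≠ 1 → TraceCode.IsWeightCode 4 (TraceCode.code p D)) ∧
      (k = 1 → TraceCode.IsWeightCode 3 (TraceCode.code p D))) ∧
    -- case 3
    (u ≠ 0 → u ^ 2 ≠ (Nat.totient (ℓ ^ k) : ZMod p) ^ 2 → u ^ 2 ≠ (ℓ : ZMod p) ^ (2 * (k - 1)) →
      TraceCode.HasWeightTable (TraceCode.code p D)
        [(0, 1),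
         ((p : ℝ) ^ (2 * e - 1), (p : ℝ) - 1),
         ((p : ℝ) ^ (2 * e - 2) * ((p : ℝ) - 1), (q : ℝ) ^ 2 - (p : ℝ))] ∧
      TraceCode.IsWeightCode 2 (TraceCode.code p D)) ∧
    -- case 4
    (u ≠ 0 → u ^ 2 = (Nat.totient (ℓ ^ k) : ZMod p) ^ 2 → u ^ 2 ≠ (ℓ : ZMod p) ^ (2 * (k - 1)) →
      TraceCode.HasWeightTable (TraceCode.code p D)
        [(0, 1),
         ((p : ℝ) ^ (2 * e - 1) - (p : ℝ) ^ (e - 1) * (((q : ℝ) - 1) / (2 * (ℓ : ℝ) ^ k)),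
           (p : ℝ) - 1),
         ((p : ℝ) ^ (2 * e - 2) * ((p : ℝ) - 1) - (p : ℝ) ^ (e - 1) * √(q : ℝ)
            + (p : ℝ) ^ (e - 1) * ((√(q : ℝ) + 1) / (2 * (ℓ : ℝ) ^ k)),
           ((p : ℝ) - 1) * (((q : ℝ) - 1) / (2 * (ℓ : ℝ) ^ k))),
         ((p : ℝ) ^ (2 * e - 2) * ((p : ℝ) - 1)
            + (p : ℝ) ^ (e - 1) * ((√(q : ℝ) + 1) / (2 * (ℓ : ℝ) ^ k)),
           ((p : ℝ) - 1) * (2 * (ℓ : ℝ) ^ k - 1) * (((q : ℝ) - 1) / (2 * (ℓ : ℝ) ^ k))),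
         ((p : ℝ) ^ (2 * e - 2) * ((p : ℝ) - 1),
           ((q : ℝ) - 1) + (q : ℝ) * ((q : ℝ) - (p : ℝ)))] ∧
      (¬ (ℓ = 3 ∧ k = 1 ∧ (p = 5 ∨ p = 11)) →
        TraceCode.IsWeightCode 4 (TraceCode.code p D)) ∧
      (ℓ = 3 ∧ k = 1 ∧ (p = 5 ∨ p = 11) →
        TraceCode.IsWeightCode 3 (TraceCode.code p D))) ∧
    -- case 5
    (u ≠ 0 →
      (u = (Nat.totient (ℓ ^ k) : ZMod p) ∧
          (Nat.totient (ℓ ^ k) : ZMod p) = (ℓ : ZMod p) ^ (k - 1)) ∨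
        (u = -(Nat.totient (ℓ ^ k) : ZMod p) ∧
          -(Nat.totient (ℓ ^ k) : ZMod p) = -(ℓ : ZMod p) ^ (k - 1)) →
      TraceCode.HasWeightTable (TraceCode.code p D)
        [(0, 1),
         ((p : ℝ) ^ (2 * e - 1) - (p : ℝ) ^ (e - 1) * (((q : ℝ) - 1) / (2 * (ℓ : ℝ) ^ (k - 1))),
           (p : ℝ) - 1),
         ((p : ℝ) ^ (2 * e - 2) * ((p : ℝ) - 1) - (p : ℝ) ^ (e - 1) * √(q : ℝ)
            + (p : ℝ) ^ (e - 1) * ((√(q : ℝ) + 1) / (2 * (ℓ : ℝ) ^ (k - 1))),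
           ((p : ℝ) - 1) * (((q : ℝ) - 1) / (2 * (ℓ : ℝ) ^ (k - 1)))),
         ((p : ℝ) ^ (2 * e - 2) * ((p : ℝ) - 1)
            + (p : ℝ) ^ (e - 1) * ((√(q : ℝ) + 1) / (2 * (ℓ : ℝ) ^ (k - 1))),
           ((p : ℝ) - 1) * (2 * (ℓ : ℝ) ^ (k - 1) - 1)
             * (((q : ℝ) - 1) / (2 * (ℓ : ℝ) ^ (k - 1)))),
         ((p : ℝ) ^ (2 * e - 2) * ((p : ℝ) - 1),
           ((q : ℝ) - 1) + (q : ℝ) * ((q : ℝ) - (p : ℝ)))] ∧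
      TraceCode.IsWeightCode 4 (TraceCode.code p D)) ∧
    -- case 6
    (u ≠ 0 → u ^ 2 ≠ (Nat.totient (ℓ ^ k) : ZMod p) ^ 2 → u ^ 2 = (ℓ : ZMod p) ^ (2 * (k - 1)) →
      TraceCode.HasWeightTable (TraceCode.code p D)
        [(0, 1),
         ((p : ℝ) ^ (2 * e - 1)
            - (p : ℝ) ^ (e - 1) * ((ℓ : ℝ) - 1) * (((q : ℝ) - 1) / (2 * (ℓ : ℝ) ^ k)),
           (p : ℝ) - 1),
         ((p : ℝ) ^ (2 * e - 2) * ((p : ℝ) - 1) - (p : ℝ) ^ (e - 1) * √(q : ℝ)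
            + (p : ℝ) ^ (e - 1) * ((ℓ : ℝ) - 1) * ((√(q : ℝ) + 1) / (2 * (ℓ : ℝ) ^ k)),
           ((p : ℝ) - 1) * ((ℓ : ℝ) - 1) * (((q : ℝ) - 1) / (2 * (ℓ : ℝ) ^ k))),
         ((p : ℝ) ^ (2 * e - 2) * ((p : ℝ) - 1)
            + (p : ℝ) ^ (e - 1) * ((ℓ : ℝ) - 1) * ((√(q : ℝ) + 1) / (2 * (ℓ : ℝ) ^ k)),
           ((p : ℝ) - 1) * (2 * (ℓ : ℝ) ^ k - (ℓ : ℝ) + 1)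
             * (((q : ℝ) - 1) / (2 * (ℓ : ℝ) ^ k))),
         ((p : ℝ) ^ (2 * e - 2) * ((p : ℝ) - 1),
           ((q : ℝ) - 1) + (q : ℝ) * ((q : ℝ) - (p : ℝ)))] ∧
      (¬ (ℓ = 3 ∧ k = 1 ∧ p = 5) → TraceCode.IsWeightCode 4 (TraceCode.code p D)) ∧
      (ℓ = 3 ∧ k = 1 ∧ p = 5 → TraceCode.IsWeightCode 3 (TraceCode.code p D))) := by
  obtain ⟨j, rfl⟩ : ∃ j, k = j + 1 := ⟨k - 1, by omega⟩
  have hp : p.Prime := Fact.out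
  have hp3 : 3 ≤ p := by have := hp.two_le; omega
  have hl3 : 3 ≤ ℓ := by have := hℓ.two_le; omega
  obtain ⟨horder, s, r, htot, hs, hM⟩ := TraceCode.exists_half_order hp hp2 hℓ hℓ2 hprim
  obtain rfl : e = 2 * (s + 1) := he.trans htot
  subst hq hD
  have hr : 0 < r := Nat.pos_of_ne_zero (by rintro rfl; simp at hM)
  have hQ : 3 ≤ p ^ (s + 1) := hp3.trans (Nat.le_self_pow (Nat.succ_ne_zero s) p)
  have hL0 : 0 < ℓ ^ (j + 1) := pow_pos hℓ.pos _
  have hLl : ℓ ≤ ℓ ^ (j + 1) := Nat.le_self_pow (Nat.succ_ne_zero j) ℓ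
  have hN' : N = (p ^ (s + 1) - 1) * r := by
    rw [hN]
    refine Nat.div_eq_of_eq_mul_left (by omega) ?_
    rw [TraceCode.mul_eq_pow_sub_one hM rfl]
    rfl
  have hN0 : N ≠ 0 := by rw [hN']; exact (Nat.mul_pos (by omega) hr).ne'
  have hNM := TraceCode.mul_eq_pow_sub_one hM hN'
  have hg : (ℓ : ZMod p) ^ j ≠ 0 := by
    refine pow_ne_zero _ fun h => hpℓ ?_
    exact (Nat.prime_dvd_prime_iff_eq hp hℓ).1 ((ZMod.natCast_eq_zero_iff ℓ p).1 h)
  have hφ : ((ℓ ^ (j + 1)).totient : ZMod p) = (ℓ : ZMod p) ^ j * ((ℓ : ZMod p) - 1) := by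
    rw [Nat.totient_prime_pow_succ hℓ, Nat.cast_mul, Nat.cast_sub hℓ.one_le]
    push_cast
    rfl
  have hroots : (Finset.univ.filter fun ω : F =>
      ω ^ (2 * ℓ ^ (j + 1)) = 1 ∧ Algebra.trace (ZMod p) F ω = u).card
      = TraceCode.rootCount ℓ j ((ℓ ^ (j + 1)).totient : ZMod p) ((ℓ : ZMod p) ^ j) u := by
    have hF' : Fintype.card F = p ^ (ℓ ^ (j + 1)).totient := by rw [hF, htot]
    have hdvd : ℓ ^ (j + 1) ∣ Fintype.card F - 1 :=
      ⟨2 * N, by rw [hF]; exact hNM.symm.trans (by ring)⟩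
    rw [TraceCode.card_filter_two_mul_root_trace_eq hp2 (hℓ.odd_of_ne_two hℓ2).pow,
      TraceCode.card_filter_root_trace_eq hℓ horder hF' hdvd,
      TraceCode.card_filter_root_trace_eq hℓ horder hF' hdvd, TraceCode.rootCount]
  have hle := TraceCode.rootCount_add_le (l := ℓ) (j := j) (u := u)
    (φ := ((ℓ ^ (j + 1)).totient : ZMod p)) hℓ.two_le hg
  obtain ⟨a₀, a₁, a₂, a₃, hw, hinj, hC⟩ :=
    TraceCode.exists_weight_distribution hp3 hF hM hN' hroots hle
  set n := TraceCode.rootCount ℓ j ((ℓ ^ (j + 1)).totient : ZMod p) ((ℓ : ZMod p) ^ j) u with hn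
  have hnM : n ≤ 2 * ℓ ^ (j + 1) := le_trans (Nat.le_add_right _ _) hle
  have hW : p ^ (2 * s + 1) ≠ 0 := (pow_pos hp.pos _).ne'
  have hf₀ := TraceCode.frequency_ne_zero (s := s) hp3
  have hf₁ : p - 1 ≠ 0 := by omega
  have hf₃ : n < 2 * ℓ ^ (j + 1) → (p - 1) * ((2 * ℓ ^ (j + 1) - n) * N) ≠ 0 := fun h =>
    mul_ne_zero hf₁ (mul_ne_zero (by omega) hN0)
  have hcode : n ≠ 0 → n < 2 * ℓ ^ (j + 1) → ∀ t, TraceCode.IsWeightCode t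
      (TraceCode.code p (TraceCode.definingSet p F N u))
        ↔ ({a₁, a₂, a₃, a₀} : Finset ℕ).card = t := fun h0 hlt =>
    TraceCode.isWeightCode_iff_card hW hC hw.ne₀ hw.ne₁ hw.ne₂ hw.ne₃ hf₀ hf₁
      (mul_ne_zero hf₁ (mul_ne_zero h0 hN0)) (hf₃ hlt)
  have hcode0 : n = 0 → ∀ t, TraceCode.IsWeightCode t
      (TraceCode.code p (TraceCode.definingSet p F N u))
        ↔ ({a₁, a₃, a₀} : Finset ℕ).card = t := fun h0 =>
    TraceCode.isWeightCode_iff_card_of_eq_zero hW hC hw.ne₀ hw.ne₁ hw.ne₃ hf₀ hf₁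
      (by rw [h0]; simp) (hf₃ (by omega))
  have h23 := hw.a₂_ne_a₃ hp.pos
  have hLr : 2 * (ℓ : ℝ) ^ (j + 1) * r = (p : ℝ) ^ (s + 1) + 1 := by exact_mod_cast hM
  have hLN : 2 * (ℓ : ℝ) ^ (j + 1) * N = (p : ℝ) ^ (2 * s + 2) - 1 := by
    have h1 : 1 ≤ p ^ (2 * s + 2) := Nat.one_le_pow _ _ hp.pos
    have h2 := congrArg (Nat.cast : ℕ → ℝ) hNM
    rw [Nat.cast_sub h1] at h2
    push_cast at h2
    linear_combination h2
  have hlR : (ℓ : ℝ) ≠ 0 := by exact_mod_cast hℓ.ne_zero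
  have hlR1 : (ℓ : ℝ) ^ (j + 1) ≠ 0 := pow_ne_zero _ hlR
  have hlR0 : (ℓ : ℝ) ^ j ≠ 0 := pow_ne_zero _ hlR
  have hsqrt : √((p : ℝ) ^ (2 * s + 2)) = (p : ℝ) ^ (s + 1) := by
    rw [show 2 * s + 2 = (s + 1) * 2 by ring, pow_mul, Real.sqrt_sq (by positivity)]
  have hq : ((p ^ (2 * (s + 1)) : ℕ) : ℝ) = (p : ℝ) ^ (2 * s + 2) := by push_cast; rfl
  -- Every quotient in the tables is `N` or `r` times a factor made of `2` and `ℓ`, so the rows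
  -- become polynomial identities.
  have dN1 : ((p : ℝ) ^ (2 * s + 2) - 1) / (ℓ : ℝ) ^ (j + 1) = 2 * N := by
    rw [div_eq_iff hlR1]; linear_combination -hLN
  have dN2 : ((p : ℝ) ^ (2 * s + 2) - 1) / (2 * (ℓ : ℝ) ^ (j + 1)) = N := by
    rw [div_eq_iff (by positivity)]; linear_combination -hLN
  have dN3 : ((p : ℝ) ^ (2 * s + 2) - 1) / (ℓ : ℝ) ^ j = 2 * ℓ * N := by
    rw [div_eq_iff hlR0]; linear_combination -hLN
  have dN4 : ((p : ℝ) ^ (2 * s + 2) - 1) / (2 * (ℓ : ℝ) ^ j) = ℓ * N := by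
    rw [div_eq_iff (by positivity)]; linear_combination -hLN
  have dr1 : ((p : ℝ) ^ (s + 1) + 1) / (ℓ : ℝ) ^ (j + 1) = 2 * r := by
    rw [div_eq_iff hlR1]; linear_combination -hLr
  have dr2 : ((p : ℝ) ^ (s + 1) + 1) / (2 * (ℓ : ℝ) ^ (j + 1)) = r := by
    rw [div_eq_iff (by positivity)]; linear_combination -hLr
  have dr3 : ((p : ℝ) ^ (s + 1) + 1) / (ℓ : ℝ) ^ j = 2 * ℓ * r := by
    rw [div_eq_iff hlR0]; linear_combination -hLr
  have dr4 : ((p : ℝ) ^ (s + 1) + 1) / (2 * (ℓ : ℝ) ^ j) = ℓ * r := by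
    rw [div_eq_iff (by positivity)]; linear_combination -hLr
  have x1 : 2 * (s + 1) - 1 = 2 * s + 1 := by omega
  have x2 : 2 * (2 * (s + 1)) - 2 = 2 * (2 * s + 1) := by omega
  have x3 : 2 * (2 * (s + 1)) - 1 = 2 * (2 * s + 1) + 1 := by omega
  simp only [hsqrt, hq, x1, x2, x3, Nat.add_sub_cancel, dN1, dN2, dN3, dN4, dr1, dr2, dr3, dr4]
  have hsq : (ℓ : ZMod p) ^ (2 * j) = ((ℓ : ZMod p) ^ j) ^ 2 := by rw [mul_comm, pow_mul]
  rw [hsq]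
  have hs1 : (s = 0) → ℓ = 3 ∧ j = 0 := by
    rintro rfl
    exact TraceCode.eq_three_of_pow_mul_eq_two hℓ hℓ2 hs
  refine ⟨?_, ?_, ?_, ?_, ?_, ?_, ?_, ?_, ?_⟩
  · rintro rfl
    exact TraceCode.card_definingSet_zero (e := 2 * s + 1) hF hN0
  · exact TraceCode.card_definingSet_of_ne_zero (e := 2 * s + 1) hF hN0
  · exact TraceCode.finrank_code_of_injective hF hinj
  · intro hu h1
    rw [if_pos hu] at hw
    have hval : n + 2 * (ℓ - 1) = 2 * ℓ ^ (j + 1) := by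
      rw [hn, hu]
      exact TraceCode.rootCount_zero_of_eq hℓ.pos hg (by rw [hφ, h1]; ring)
    have hnR : (n : ℝ) = 2 * (ℓ : ℝ) ^ (j + 1) - 2 * ((ℓ : ℝ) - 1) := by
      have h2 := congrArg (Nat.cast : ℕ → ℝ) hval
      push_cast [Nat.cast_sub hℓ.one_le] at h2
      linear_combination h2
    -- Here `φ = 0` modulo `p`, so the roots of nonzero trace are the `2 * (ℓ - 1)` elements `±ω`
    -- with `ω` of order `ℓ`. Both this number and `n` are even, which excludes all coincidences
    -- requiring a power of the odd prime `p`.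
    obtain ⟨c10, c20, c30, c12, c13⟩ := hw.eq_cases_of_eq hp3 hM hN' hval (by omega)
    have hodd := TraceCode.even_mul_ne_prime_pow (i := s + 1) hp hp2 hM (even_two_mul (ℓ - 1))
    have hpdvd : p ∣ ℓ - 1 := by
      rw [← ZMod.natCast_eq_zero_iff, Nat.cast_sub hℓ.one_le, h1]
      simp
    refine ⟨(TraceCode.hasWeightTable_of_distribution hw hnM hC ?_ ?_ ?_ ?_ ?_ ?_ ?_ ?_).swap,
      (hcode (by omega) (by omega) 4).2 (TraceCode.card_four_eq_four
        (fun h => TraceCode.two_mul_sub_one_mul_add_ne hp hp2 hℓ hℓ2 hM hs hpdvd (c12 h))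
        (fun h => TraceCode.even_mul_ne_prime_pow hp hp2 hM
          (show Even n from ⟨ℓ ^ (j + 1) - (ℓ - 1), by omega⟩) (c13 h))
        (fun h => hodd (c10 h)) h23 c20 (fun h => hodd (c30 h)))⟩
    · ring
    · push_cast
      rw [hnR]
      linear_combination (p : ℝ) ^ (2 * s + 1) * hLN
    · push_cast
      rw [hnR]
      linear_combination -(p : ℝ) ^ (2 * s + 1) * hLr
    · push_cast
      rw [hnR]
      linear_combination -(p : ℝ) ^ (2 * s + 1) * hLr
    · ring
    · ring
    · rw [hnR]
      ring
    · push_cast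
      rw [hnR]
      ring
  · intro hu h1
    rw [if_pos hu] at hw
    have hval : n + 2 * ℓ = 2 * ℓ ^ (j + 1) := by
      rw [hn, hu]
      refine TraceCode.rootCount_zero_of_ne hg ?_
      rw [hφ]
      exact mul_ne_zero hg (sub_ne_zero.2 h1)
    have hnR : (n : ℝ) = 2 * (ℓ : ℝ) ^ (j + 1) - 2 * (ℓ : ℝ) := by
      have h2 := congrArg (Nat.cast : ℕ → ℝ) hval
      push_cast at h2
      linear_combination h2
    obtain ⟨c10, c20, c30, c12, c13⟩ := hw.eq_cases_of_eq hp3 hM hN' hval (by omega)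
    have hodd := TraceCode.even_mul_ne_prime_pow (i := s + 1) hp hp2 hM (even_two_mul ℓ)
    have c13' : a₁ ≠ a₃ := fun h => TraceCode.even_mul_ne_prime_pow hp hp2 hM
      (show Even n from ⟨ℓ ^ (j + 1) - ℓ, by omega⟩) (c13 h)
    refine ⟨(TraceCode.hasWeightTable_of_distribution hw hnM hC ?_ ?_ ?_ ?_ ?_ ?_ ?_ ?_).swap,
      fun hj => ?_, fun hj => ?_⟩
    · ring
    · push_cast
      rw [hnR]
      linear_combination (p : ℝ) ^ (2 * s + 1) * hLN
    · push_cast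
      rw [hnR]
      linear_combination -(p : ℝ) ^ (2 * s + 1) * hLr
    · push_cast
      rw [hnR]
      linear_combination -(p : ℝ) ^ (2 * s + 1) * hLr
    · ring
    · ring
    · rw [hnR]
      ring
    · push_cast
      rw [hnR]
      ring
    · have hj0 : j ≠ 0 := by omega
      have hlt : ℓ < ℓ ^ (j + 1) := lt_self_pow₀ hℓ.one_lt (by omega)
      exact (hcode (by omega) (by omega) 4).2 (TraceCode.card_four_eq_four
        (fun h => TraceCode.two_mul_prime_mul_add_ne hp hp2 hℓ hℓ2 hpℓ hM hs hj0 (c12 h))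
        c13' (fun h => hodd (c10 h)) h23 c20 (fun h => hodd (c30 h)))
    · obtain rfl : j = 0 := by omega
      have hn0 : n = 0 := by
        rw [zero_add, pow_one] at hval
        omega
      rw [hcode0 hn0, Finset.card_insert_of_notMem, Finset.card_pair]
      · exact fun h => hodd (c30 h)
      · simp only [Finset.mem_insert, Finset.mem_singleton, not_or]
        exact ⟨c13', fun h => hodd (c10 h)⟩
  · intro hu h1 h2
    rw [if_neg hu] at hw
    have hval : n = 0 := TraceCode.rootCount_of_ne_of_ne hu h1 h2
    obtain ⟨c10, -⟩ := hw.eq_cases_of_ne hp3 hN'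
    -- With `n = 0` the row of `a₂` is void and the rows of `a₃` and `a₀` merge, with total
    -- frequency `(p - 1) * (q - 1) + (q - 1) + (q - p) * q = q ^ 2 - p`.
    have h30 : a₃ = a₀ := by
      have := hw.eq₃
      rw [hval] at this
      omega
    constructor
    · intro w
      have ht := TraceCode.hasWeightTable_of_distribution hw hnM hC rfl rfl rfl rfl rfl rfl rfl rfl
      rw [ht w]
      have e1 : (p : ℝ) ^ (2 * s + 1) * ((p : ℝ) ^ (2 * s + 2) - ((0 : ℕ) : ℝ) - n * N)
          = (p : ℝ) ^ (2 * (2 * s + 1) + 1) := by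
        rw [hval]
        push_cast
        ring
      have e3 : (p : ℝ) ^ (2 * s + 1) * ((p : ℝ) ^ (2 * s + 2) - (p : ℝ) ^ (2 * s + 1)
          + n * r - ((0 : ℕ) : ℝ)) = (p : ℝ) ^ (2 * (2 * s + 1)) * ((p : ℝ) - 1) := by
        rw [hval]
        push_cast
        ring
      have e0 : (p : ℝ) ^ (2 * s + 1) * ((p : ℝ) ^ (2 * s + 2) - (p : ℝ) ^ (2 * s + 1))
          = (p : ℝ) ^ (2 * (2 * s + 1)) * ((p : ℝ) - 1) := by
        ring
      have e2 : ((p : ℝ) - 1) * ((n : ℝ) * N) = 0 := by rw [hval]; simp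
      have e4 : ((p : ℝ) - 1) * ((((2 * ℓ ^ (j + 1) : ℕ) : ℝ) - n) * N)
          = ((p : ℝ) - 1) * ((p : ℝ) ^ (2 * s + 2) - 1) := by
        rw [hval, ← hLN]
        push_cast
        ring
      simp only [List.map_cons, List.map_nil, List.sum_cons, List.sum_nil, e0, e1, e2, e3, e4,
        ite_self]
      split_ifs <;> ring
    · rw [hcode0 hval, h30, Finset.pair_eq_singleton, Finset.card_pair c10]
  · intro hu h1 h2
    rw [if_neg hu] at hw
    have hval : n = 1 := TraceCode.rootCount_of_eq_of_ne hp2 hu h1 h2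
    obtain ⟨c10, c20, c30, c12, c13⟩ := hw.eq_cases_of_ne hp3 hN'
    rw [hval, one_mul] at c20 c30 c12 c13
    refine ⟨TraceCode.hasWeightTable_of_distribution hw hnM hC ?_ ?_ ?_ ?_ ?_ ?_ ?_ ?_,
      fun hexc => ?_, fun hexc => ?_⟩
    · ring
    · rw [hval]; push_cast; ring
    · rw [hval]; push_cast; ring
    · rw [hval]; push_cast; ring
    · ring
    · ring
    · rw [hval]; push_cast; ring
    · rw [hval]; push_cast; ring
    · refine (hcode (by omega) (by omega) 4).2 (TraceCode.card_four_eq_four (fun h => ?_)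
        (fun h => ?_) c10 h23 (fun h => ?_) (fun h => hr.ne' (c30 h)))
      · obtain ⟨h3, h0, h11⟩ := TraceCode.eq_eleven_of_eq_add_one hp hℓ hℓ2 hM hs (c12 h)
        exact hexc ⟨h3, by omega, Or.inr h11⟩
      -- `a₁ = a₃` requires `r = p ^ s`, so `r = 1` and `s = 0`, whence `ℓ = 3` and `p + 1 = 6`.
      · obtain ⟨hr1, hT⟩ := TraceCode.eq_one_of_mul_eq_prime_pow (n := 1) hp hM
          ((one_mul r).trans (c13 h))
        have hs0 : s = 0 := by
          by_contra h0
          exact (Nat.one_lt_pow h0 hp.one_lt).ne hT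
        obtain ⟨h3, h0⟩ := hs1 hs0
        refine hexc ⟨h3, by omega, Or.inl ?_⟩
        rw [h3, h0, hs0, hr1] at hM
        norm_num at hM
        omega
      · have := (TraceCode.eq_one_of_mul_eq_prime_pow (n := 1) hp hM
          ((one_mul r).trans (c20 h))).2
        omega
    · obtain ⟨rfl, hj, hp'⟩ := hexc
      obtain rfl : j = 0 := by omega
      obtain rfl : s = 0 := by omega
      rw [hcode (by omega) (by omega)]
      have e₀ := hw.eq₀
      have e₁ := hw.eq₁
      have e₂ := hw.eq₂
      have e₃ := hw.eq₃
      rw [hval] at e₁ e₂ e₃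
      -- For `p = 5` the coincidence is `a₁ = a₃`; for `p = 11` it is `a₁ = a₂`.
      rcases hp' with rfl | rfl
      · obtain rfl : r = 1 := by omega
        obtain rfl : a₀ = 20 := by omega
        obtain rfl : a₁ = 21 := by omega
        obtain rfl : a₂ = 16 := by omega
        obtain rfl : a₃ = 21 := by omega
        rfl
      · obtain rfl : r = 2 := by omega
        obtain rfl : a₀ = 110 := by omega
        obtain rfl : a₁ = 101 := by omega
        obtain rfl : a₂ = 101 := by omega
        obtain rfl : a₃ = 112 := by omega
        rfl
  · intro hu h
    rw [if_neg hu] at hw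
    have hval : n = ℓ := TraceCode.rootCount_of_eq_of_eq hp2 hℓ.pos hu h
    obtain ⟨c10, c20, c30, c12, c13⟩ := hw.eq_cases_of_ne hp3 hN'
    rw [hval] at c20 c30 c12 c13
    refine ⟨TraceCode.hasWeightTable_of_distribution hw hnM hC ?_ ?_ ?_ ?_ ?_ ?_ ?_ ?_,
      (hcode (by omega) (by omega) 4).2 (TraceCode.card_four_eq_four
        (fun h => TraceCode.prime_mul_ne_add_one hp hℓ hℓ2 hM (c12 h))
        (fun h => TraceCode.prime_mul_ne_prime_pow hp hℓ hpℓ hM (c13 h)) c10 h23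
        (fun h => TraceCode.prime_mul_ne_prime_pow hp hℓ hpℓ hM (c20 h))
        (fun h => mul_ne_zero hℓ.ne_zero hr.ne' (c30 h)))⟩
    · ring
    · rw [hval]; push_cast; ring
    · rw [hval]; push_cast; ring
    · rw [hval]; push_cast; ring
    · ring
    · ring
    · rw [hval]
    · rw [hval]; push_cast; ring
  · intro hu h1 h2
    rw [if_neg hu] at hw
    have hval : n = ℓ - 1 := TraceCode.rootCount_of_ne_of_eq hp2 hu h1 h2
    have hnR : (n : ℝ) = (ℓ : ℝ) - 1 := by
      rw [hval, Nat.cast_sub hℓ.one_le, Nat.cast_one]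
    obtain ⟨c10, c20, c30, c12, c13⟩ := hw.eq_cases_of_ne hp3 hN'
    rw [hval] at c20 c30 c12 c13
    have heven : Even (ℓ - 1) := Nat.Odd.sub_odd (hℓ.odd_of_ne_two hℓ2) odd_one
    refine ⟨TraceCode.hasWeightTable_of_distribution hw hnM hC ?_ ?_ ?_ ?_ ?_ ?_ ?_ ?_,
      fun hexc => ?_, fun hexc => ?_⟩
    · ring
    · rw [hnR]; push_cast; ring
    · rw [hnR]; push_cast; ring
    · rw [hnR]; push_cast; ring
    · ring
    · ring
    · rw [hnR]; ring
    · rw [hnR]; push_cast; ring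
    -- For `p = 3` and `ℓ = 5` one has `φ (ℓ ^ k) = 4 * 5 ^ j`, congruent to `5 ^ j` modulo `3`, so
    -- the two hypotheses on `u ^ 2` contradict each other.
    · have h35 : ¬ (p = 3 ∧ ℓ = 5) := by
        rintro ⟨rfl, rfl⟩
        refine h1 (h2.trans ?_)
        have h30 : (3 : ZMod 3) = 0 := by exact_mod_cast ZMod.natCast_self 3
        rw [hφ]
        push_cast
        linear_combination (-5 * ((5 : ZMod 3) ^ j) ^ 2) * h30
      refine (hcode (by omega) (by omega) 4).2 (TraceCode.card_four_eq_four (fun h => ?_)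
        (fun h => TraceCode.even_mul_ne_prime_pow hp hp2 hM heven (c13 h)) c10 h23
        (fun h => TraceCode.even_mul_ne_prime_pow hp hp2 hM heven (c20 h))
        (fun h => mul_ne_zero (by omega) hr.ne' (c30 h)))
      obtain ⟨h3, h0, h5⟩ := TraceCode.eq_five_of_sub_one_mul_eq hp hp2 hℓ hℓ2 hpℓ hM hs h35 (c12 h)
      exact hexc ⟨h3, by omega, h5⟩
    · obtain ⟨rfl, hj, rfl⟩ := hexc
      obtain rfl : j = 0 := by omega
      obtain rfl : s = 0 := by omega
      rw [hcode (by omega) (by omega)]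
      have e₀ := hw.eq₀
      have e₁ := hw.eq₁
      have e₂ := hw.eq₂
      have e₃ := hw.eq₃
      rw [hval] at e₁ e₂ e₃
      obtain rfl : r = 1 := by omega
      obtain rfl : a₀ = 20 := by omega
      obtain rfl : a₁ = 17 := by omega
      obtain rfl : a₂ = 17 := by omega
      obtain rfl : a₃ = 22 := by omega
      rfl
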